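/- **Lemma (Trace inequalities).** *Setting.* Let $\hat\Omega\subset\mathbb R^2$ be a bounded open set with Lipschitz boundary, and let $\mathbf x:\overline{\hat\Omega}\to\mathbb R^3$ be a $C^1$ immersion (up to the boundary) with image the midsurface $\Omega$ of a shell of thickness $\zeta>0$, Young's modulus $E>0$ and Poisson ratio $0\le\nu\le\frac12$. Let $\mathcal K$ be a finite mesh of $\Omega$ by non-overlapping mapped polygons: $\hat\Omega$ is the interior of the union of closed sets $\hat K=\varphi_K(P_K)$ with disjoint interiors, where $P_K$ is a closed polygon and $\varphi_K$ a $C^3$ diffeomorphism between open sets, with $P_K$ in its domain, and $K=\mathbf x(\hat K)$. Assume that $\mathbf x$ is $C^3$ on each $\hat K$ (for instance $\mathbf x\in C^3(\overline{\hat\Omega})$). Let $\mathcal E$ be a finite edge mesh of $\Gamma=\partial\Omega$ whose members $E_0$ are mapped straight boundary edges of elements; for an edge $E_0$ of $K$ put $h_{E_0}=h_K=\operatorname{diam}K$. Let $\Gamma_{D_1},\Gamma_{D_2}\subset\Gamma$ each be the relative interior of the closure of the union of the edges $\mathcal E_{D_\alpha}=\{E_0\in\mathcal E: E_0\subset\Gamma_{D_\alpha}\}$.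 Let $\chi_D$ be the set of those corners of $\Gamma$ (points where the unit tangent jumps) that lie in $\overline{\Gamma_{D_1}}$; for $C\in\chi_D$ let $h_C=h_K$ for a chosen element $K$ whose closure contains $C$. Let $\mathcal V_h$ be a finite-dimensional vector space of displacement fields $\mathbf v:\overline\Omega\to\mathbb R^3$, viewed as functions on $\overline{\hat\Omega}$, that are $C^1$ up to the boundary and whose components, pulled back to each $P_K$, are quotients of polynomials in two variables with denominators that do not vanish on $P_K$. *Notation.* Let $\mathbf a_\alpha=\mathbf x_{,\alpha}$, let $\mathbf a^\alpha$ be the dual basis of the tangent plane, $\mathbf a_3=\mathbf a_1\times\mathbf a_2/|\mathbf a_1\times\mathbf a_2|$, $P=I-\mathbf a_3\otimes\mathbf a_3$, $b=(\mathbf a_3\cdot\mathbf a_{\alpha,\beta})\,\mathbf a^\alpha\otimes\mathbf a^\beta$, $\nabla w=w_{,\lambda}\otimes\mathbf a^\lambda$, $\nabla\cdot M=M_{,\lambda}\cdot\mathbf a^\lambda$; on boundary edges let $t$ be the positively oriented unit tangent and $n=t\times\mathbf a_3$ the outward unit normal. Let $\mathbb C=\mathbb C^{\alpha\beta\lambda\mu}\mathbf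 a_\alpha\otimes\mathbf a_\beta\otimes\mathbf a_\lambda\otimes\mathbf a_\mu$ with $$\mathbb C^{\alpha\beta\lambda\mu}=\tfrac{E}{2(1+\nu)}\Big(a^{\alpha\lambda}a^{\beta\mu}+a^{\alpha\mu}a^{\beta\lambda}+\tfrac{2\nu}{1-\nu}a^{\alpha\beta}a^{\lambda\mu}\Big),\qquad |\mathbb C|^2=\mathbb C^{\alpha\beta\lambda\mu}\mathbb C_{\alpha\beta\lambda\mu}.$$ The strains and stresses are $\alpha(\mathbf v)=P\,\mathrm{Sym}(\nabla\mathbf v)P$, $\beta(\mathbf v)=-P\,\mathrm{Sym}(\mathbf a_3\cdot\nabla\nabla\mathbf v)P$, $A=\zeta\,\mathbb C:\alpha$, $B=\frac{\zeta^3}{12}\mathbb C:\beta$, and $$a^S(\mathbf w,\mathbf v)=\int_\Omega A(\mathbf w):\alpha(\mathbf v)\,d\Omega+\int_\Omega B(\mathbf w):\beta(\mathbf v)\,d\Omega .$$ Further $B_{nn}=n\cdot B\cdot n$, $B_{nt}=n\cdot B\cdot t$, $T^{(A)}=A\cdot n$, $T^{(B)}=-b\cdot(B\cdot n+t\,B_{nt})$,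 $T_3=(\nabla\cdot B)\cdot n+\partial B_{nt}/\partial t$, and $[\![B_{nt}]\!]$ is the value of $B_{nt}$ just after a corner minus its value just before it. All derivatives of $\mathbf v\in\mathcal V_h$ are taken element by element, and on a boundary edge from within the adjacent element. *Claim 1.* For given $\mathbf x$, mesh, Dirichlet boundaries, $\mathcal V_h$ and $\nu$ there are constants $C_1,\dots,C_5>0$, independent of $\zeta$ and $E$, such that for all $\zeta,E>0$ and all $\mathbf v\in\mathcal V_h$ each of the following five quantities is at most $\frac15a^S(\mathbf v,\mathbf v)$: $$\sum_{E_1\in\mathcal E_{D_1}}\int_{E_1}\frac{h_{E_1}^3}{C_1\zeta^3|\mathbb C|}T_3(\mathbf v)^2\,d\Gamma,\qquad \sum_{C\in\chi_D}\frac{h_C^2}{C_2\zeta^3|\mathbb C|}[\![B_{nt}(\mathbf v)]\!]^2\Big|_C,\qquad \sum_{E_2\in\mathcal E_{D_2}}\int_{E_2}\frac{h_{E_2}}{C_3\zeta^3|\mathbb C|}B_{nn}(\mathbf v)^2\,d\Gamma,$$ $$\sum_{E_1\in\mathcal E_{D_1}}\int_{E_1}\frac{h_{E_1}}{C_4\zeta^3|\mathbb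 C|}|T^{(B)}(\mathbf v)|^2\,d\Gamma,\qquad \sum_{E_1\in\mathcal E_{D_1}}\int_{E_1}\frac{h_{E_1}}{C_5\zeta|\mathbb C|}|T^{(A)}(\mathbf v)|^2\,d\Gamma .$$ *Claim 2.* Let $\mathrm{Rig}=\{\mathbf r\in\mathcal V_h:\alpha(\mathbf r)=\beta(\mathbf r)=0\}$ and let $\mathring{\mathcal V}_h$ be its $L^2(\Omega)$-orthogonal complement in $\mathcal V_h$; assume $\mathring{\mathcal V}_h\ne\{0\}$. Fix $\zeta,E>0$ and $k\in\{1,\dots,5\}$, and let $q_k(\cdot,\cdot)$ be the symmetric bilinear form whose quadratic form is the $k$-th quantity above with $C_k=1$. Then the generalized eigenproblem: find $(\mathbf u,\lambda)$, $0\neq\mathbf u\in\mathring{\mathcal V}_h$, with $q_k(\mathbf u,\mathbf w)=\lambda\,a^S(\mathbf u,\mathbf w)$ for all $\mathbf w\in\mathring{\mathcal V}_h$, has a largest eigenvalue $\lambda_{\max,k}$; it is nonnegative, and for fixed $\zeta,E$ the $k$-th inequality holds for all $\mathbf v\in\mathcal V_h$ with the constant $C_k=c>0$ if and only if $c\ge5\lambda_{\max,k}$.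 -/

import Mathlib

open Set Filter Topology MeasureTheory Matrix

noncomputable section

/-- The plane of the convective coordinates `(ξ¹, ξ²)`. -/
abbrev Plane := Fin 2 → ℝ

/-- Three-dimensional space; Euclidean lengths are written with the dot product. -/
abbrev Space := Fin 3 → ℝ

/-- Second-order tensors on three-dimensional space. -/
abbrev Tensor := Matrix (Fin 3) (Fin 3) ℝ

/-- Euclidean length in three-dimensional space. -/
def Space.length (v : Space) : ℝ := √(v ⬝ᵥ v)

/-- A closed polygon: a finite union of nondegenerate closed triangles, with connected interior. -/
def IsPolygon (P : Set Plane) : Prop :=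
  (∃ F : Finset (Fin 3 → Plane), (∀ T ∈ F, AffineIndependent ℝ T) ∧
    P = ⋃ T ∈ F, convexHull ℝ (range T)) ∧ IsConnected (interior P)

/-- Near each of its boundary points the set is, in suitable linear coordinates, the region above
the graph of a Lipschitz function. -/
def HasLipschitzBoundary (U : Set Plane) : Prop :=
  ∀ p ∈ frontier U, ∃ (R : Plane ≃L[ℝ] Plane) (g : ℝ → ℝ) (L : NNReal), LipschitzWith L g ∧
    ∀ᶠ q in 𝓝 p, (q ∈ U ↔ g (R q 0) < R q 1)

/-- Rotation of the plane by a right angle, counterclockwise. -/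
def Plane.rotateLeft (v : Plane) : Plane := ![-v 1, v 0]

/-- Symmetric part of a tensor. -/
def Tensor.sym (M : Tensor) : Tensor := (1 / 2 : ℝ) • (M + Mᵀ)

/-- The double contraction `M : N` of two tensors. -/
def Tensor.ddot (M N : Tensor) : ℝ := ∑ i, ∑ j, M i j * N i j

/-- The raw data of a meshed midsurface with Dirichlet boundaries. -/
structure ShellData where
  /-- the parametric domain -/
  dom : Set Plane
  /-- the geometric mapping; the midsurface is the image of `dom` -/
  x : Plane → Space
  /-- the number of elements -/
  nElem : ℕ
  /-- the reference polygon of an element -/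
  ref : Fin nElem → Set Plane
  /-- the map that carries the reference polygon into the parametric domain -/
  chart : Fin nElem → OpenPartialHomeomorph Plane Plane
  /-- the number of boundary edges -/
  nEdge : ℕ
  /-- the element of which a boundary edge is an edge -/
  edgeElem : Fin nEdge → Fin nElem
  /-- initial point of a boundary edge, in the reference polygon of its element -/
  edgeStart : Fin nEdge → Plane
  /-- final point of a boundary edge, in the reference polygon of its element -/
  edgeEnd : Fin nEdge → Plane
  /-- the element associated with the boundary vertex in which a boundary edge starts -/
  vertexElem : Fin nEdge → Fin nElem
  /-- the Dirichlet-1 boundary (index `0`) and the Dirichlet-2 boundary (index `1`), in the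
  parametric domain -/
  ΓD : Fin 2 → Set Plane

namespace ShellData

variable (S : ShellData)

/-! ### Elements and edges -/

/-- The closed element, in the parametric domain. -/
def cell (i : Fin S.nElem) : Set Plane := S.chart i '' S.ref i

/-- The mesh size `h_K`: the Euclidean diameter of the element on the midsurface. -/
def elemSize (i : Fin S.nElem) : ℝ := Metric.diam (WithLp.toLp 2 '' (S.x '' S.cell i))

/-- The parametrization by `[0, 1]` of a boundary edge, in the parametric domain. -/
def edgeCurve (e : Fin S.nEdge) (s : ℝ) : Plane :=
  S.chart (S.edgeElem e) (AffineMap.lineMap (S.edgeStart e) (S.edgeEnd e) s)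

/-- The boundary edge without its end points, in the parametric domain. -/
def openEdge (e : Fin S.nEdge) : Set Plane := S.edgeCurve e '' Ioo 0 1

/-- The edge size `h_E`. -/
def edgeSize (e : Fin S.nEdge) : ℝ := S.elemSize (S.edgeElem e)

open Classical in
/-- The edge meshes `ℰ_{D_1}` (index `0`) and `ℰ_{D_2}` (index `1`). -/
def dirichletEdges (k : Fin 2) : Finset (Fin S.nEdge) :=
  Finset.univ.filter fun e => S.openEdge e ⊆ S.ΓD k

/-- The standing assumptions on the midsurface, its mesh and its Dirichlet boundaries. -/
structure IsAdmissible : Prop where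
  isOpen_dom : IsOpen S.dom
  lipschitz_dom : HasLipschitzBoundary S.dom
  /-- the elements are mapped polygons -/
  polygon : ∀ i, IsPolygon (S.ref i)
  ref_subset : ∀ i, S.ref i ⊆ (S.chart i).source
  chart_smooth : ∀ i, ContDiffOn ℝ 3 (S.chart i) (S.chart i).source
  chart_symm_smooth : ∀ i, ContDiffOn ℝ 3 (S.chart i).symm (S.chart i).target
  /-- the elements do not overlap -/
  cell_disjoint : ∀ i j, i ≠ j → Disjoint (interior (S.cell i)) (interior (S.cell j))
  /-- the elements fill the domain -/
  dom_eq : S.dom = interior (⋃ i, S.cell i)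
  /-- the midsurface is continuously differentiable, and three times so up to the boundary of each
  element -/
  x_smooth : ContDiffOn ℝ 1 S.x (closure S.dom)
  x_smooth_cell : ∀ i, ContDiffOn ℝ 3 S.x (S.cell i)
  /-- the geometric mapping is nondegenerate, that is, an immersion -/
  x_immersion : ∀ p ∈ closure S.dom, Function.Injective (fderivWithin ℝ S.x (closure S.dom) p)
  edge_ne : ∀ e, S.edgeStart e ≠ S.edgeEnd e
  /-- boundary edges are edges of elements -/
  edge_subset : ∀ e, segment ℝ (S.edgeStart e) (S.edgeEnd e) ⊆ frontier (S.ref (S.edgeElem e))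
  /-- the boundary edges do not overlap -/
  edge_disjoint : ∀ e f, e ≠ f → Disjoint (S.openEdge e) (S.openEdge f)
  /-- the boundary edges make up the boundary -/
  frontier_eq : frontier S.dom = ⋃ e, S.edgeCurve e '' Icc 0 1
  /-- edges are positively oriented: the element lies on their left -/
  edge_oriented : ∀ e, ∀ s ∈ Ioo (0 : ℝ) 1, ∀ᶠ r in 𝓝[>] (0 : ℝ),
    S.edgeCurve e s + r • Plane.rotateLeft (derivWithin (S.edgeCurve e) (Icc 0 1) s) ∈
      interior (S.cell (S.edgeElem e))
  vertexElem_mem : ∀ e, S.edgeCurve e 0 ∈ S.cell (S.vertexElem e)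
  /-- each Dirichlet boundary is the interior, relative to the boundary, of the closure of the
  union of its edges -/
  ΓD_eq : ∀ k, S.ΓD k = {p ∈ frontier S.dom |
    closure (⋃ e ∈ S.dirichletEdges k, S.openEdge e) ∈ 𝓝[frontier S.dom] p}

/-! ### Differential geometry of the midsurface, on a closed element -/

/-- The partial derivative `∂f/∂ξ^α`, taken from within the closed element. -/
def pd {F : Type*} [NormedAddCommGroup F] [NormedSpace ℝ F] (i : Fin S.nElem) (α : Fin 2)
    (f : Plane → F) (p : Plane) : F :=
  fderivWithin ℝ f (S.cell i) p (Pi.single α 1)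

/-- The partial derivative of a tensor field with respect to `ξ^α`. -/
def pdTensor (i : Fin S.nElem) (α : Fin 2) (T : Plane → Tensor) (p : Plane) : Tensor :=
  Matrix.of fun j k => S.pd i α (fun q => T q j k) p

/-- The covariant basis vectors `a_α`. -/
def cov (i : Fin S.nElem) (α : Fin 2) (p : Plane) : Space := S.pd i α S.x p

/-- The covariant metric coefficients. -/
def metric (i : Fin S.nElem) (p : Plane) : Matrix (Fin 2) (Fin 2) ℝ :=
  Matrix.of fun α β => S.cov i α p ⬝ᵥ S.cov i β p

/-- The contravariant basis vectors `a^α`. -/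
def con (i : Fin S.nElem) (α : Fin 2) (p : Plane) : Space :=
  ∑ μ, (S.metric i p)⁻¹ α μ • S.cov i μ p

/-- The midsurface normal director `a_3`. -/
def director (i : Fin S.nElem) (p : Plane) : Space :=
  (Space.length (crossProduct (S.cov i 0 p) (S.cov i 1 p)))⁻¹ •
    crossProduct (S.cov i 0 p) (S.cov i 1 p)

/-- The density of the surface measure with respect to `dξ¹ dξ²`. -/
def areaDensity (i : Fin S.nElem) (p : Plane) : ℝ := √(S.metric i p).det

/-- The curvature tensor `b = b_{αβ} a^α ⊗ a^β`, where `b_{αβ} = a_3 · a_{α,β}`. -/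
def curvature (i : Fin S.nElem) (p : Plane) : Tensor :=
  ∑ α, ∑ β, (S.director i p ⬝ᵥ S.pd i β (S.cov i α) p) • vecMulVec (S.con i α p) (S.con i β p)

/-- The in-plane projector. -/
def proj (i : Fin S.nElem) (p : Plane) : Tensor :=
  1 - vecMulVec (S.director i p) (S.director i p)

/-- The surface gradient `∇w = w_{,λ} ⊗ a^λ`. -/
def grad (i : Fin S.nElem) (w : Plane → Space) (p : Plane) : Tensor :=
  ∑ κ, vecMulVec (S.pd i κ w p) (S.con i κ p)

/-- The tensor `a_3 · ∇∇w`, where `∇∇w = (∇w)_{,μ} ⊗ a^μ`. -/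
def normalHessian (i : Fin S.nElem) (w : Plane → Space) (p : Plane) : Tensor :=
  ∑ μ, vecMulVec (S.director i p ᵥ* S.pdTensor i μ (S.grad i w) p) (S.con i μ p)

/-- The surface divergence of a tensor field, `∇ · T = T_{,α} · a^α`. -/
def divergence (i : Fin S.nElem) (T : Plane → Tensor) (p : Plane) : Space :=
  ∑ α, S.pdTensor i α T p *ᵥ S.con i α p

/-! ### Strains, stresses and the strain energy -/

/-- The membrane strain `α(w) = P · Sym(∇w) · P`. -/
def memStrain (i : Fin S.nElem) (w : Plane → Space) (p : Plane) : Tensor :=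
  S.proj i p * Tensor.sym (S.grad i w p) * S.proj i p

/-- The bending strain `β(w) = - P · Sym(a_3 · ∇∇w) · P`. -/
def bendStrain (i : Fin S.nElem) (w : Plane → Space) (p : Plane) : Tensor :=
  -(S.proj i p * Tensor.sym (S.normalHessian i w p) * S.proj i p)

/-- The coefficients of the elasticity tensor in terms of the metric coefficients `g`:
contravariant ones if `g` is the contravariant metric, covariant ones if `g` is the covariant
metric. `E` is Young's modulus and `ν` is Poisson's ratio. -/
def elasticityCoeff (E ν : ℝ) (g : Matrix (Fin 2) (Fin 2) ℝ) (α β κ μ : Fin 2) : ℝ :=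
  E / (2 * (1 + ν)) *
    (g α κ * g β μ + g α μ * g β κ + 2 * ν / (1 - ν) * (g α β * g κ μ))

/-- The magnitude `|ℂ|`, with `|ℂ|² = ℂ^{αβλμ} ℂ_{αβλμ}`. -/
def elasticityNorm (E ν : ℝ) (i : Fin S.nElem) (p : Plane) : ℝ :=
  √(∑ α, ∑ β, ∑ κ, ∑ μ,
    elasticityCoeff E ν (S.metric i p)⁻¹ α β κ μ * elasticityCoeff E ν (S.metric i p) α β κ μ)

/-- The double contraction `ℂ : M`, where `ℂ = ℂ^{αβλμ} a_α ⊗ a_β ⊗ a_λ ⊗ a_μ`. -/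
def elasticity (E ν : ℝ) (i : Fin S.nElem) (p : Plane) (M : Tensor) : Tensor :=
  ∑ α, ∑ β, ∑ κ, ∑ μ,
    (elasticityCoeff E ν (S.metric i p)⁻¹ α β κ μ * (S.cov i κ p ⬝ᵥ M *ᵥ S.cov i μ p)) •
      vecMulVec (S.cov i α p) (S.cov i β p)

/-- The membrane stress `A(w) = ζ ℂ : α(w)`, for the thickness `ζ`. -/
def memStress (E ν ζ : ℝ) (i : Fin S.nElem) (w : Plane → Space) (p : Plane) : Tensor :=
  ζ • S.elasticity E ν i p (S.memStrain i w p)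

/-- The bending stress `B(w) = (ζ³ / 12) ℂ : β(w)`. -/
def bendStress (E ν ζ : ℝ) (i : Fin S.nElem) (w : Plane → Space) (p : Plane) : Tensor :=
  (ζ ^ 3 / 12) • S.elasticity E ν i p (S.bendStrain i w p)

/-- The bilinear form `a^S(w, v) = ∫_Ω A(w) : α(v) dΩ + ∫_Ω B(w) : β(v) dΩ`. -/
def energy (E ν ζ : ℝ) (w v : Plane → Space) : ℝ :=
  (∑ i, ∫ p in S.cell i,
    Tensor.ddot (S.memStress E ν ζ i w p) (S.memStrain i v p) * S.areaDensity i p) +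
  ∑ i, ∫ p in S.cell i,
    Tensor.ddot (S.bendStress E ν ζ i w p) (S.bendStrain i v p) * S.areaDensity i p

/-- The `L²` inner product over the midsurface. -/
def innerL2 (w v : Plane → Space) : ℝ :=
  ∑ i, ∫ p in S.cell i, (w p ⬝ᵥ v p) * S.areaDensity i p

/-! ### Boundary quantities, along an edge parametrized by `[0, 1]` -/

/-- The non-normalized tangent vector of a boundary edge. -/
def edgeVel (e : Fin S.nEdge) (s : ℝ) : Space :=
  derivWithin (fun r => S.x (S.edgeCurve e r)) (Icc 0 1) s

/-- The boundary Jacobian. -/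
def edgeSpeed (e : Fin S.nEdge) (s : ℝ) : ℝ := Space.length (S.edgeVel e s)

/-- The positively oriented unit tangent vector `t`. -/
def tangent (e : Fin S.nEdge) (s : ℝ) : Space := (S.edgeSpeed e s)⁻¹ • S.edgeVel e s

/-- The outward unit normal vector `n = t × a_3`. -/
def normal (e : Fin S.nEdge) (s : ℝ) : Space :=
  crossProduct (S.tangent e s) (S.director (S.edgeElem e) (S.edgeCurve e s))

/-- The bending stress along a boundary edge. -/
def edgeBend (E ν ζ : ℝ) (e : Fin S.nEdge) (w : Plane → Space) (s : ℝ) : Tensor :=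
  S.bendStress E ν ζ (S.edgeElem e) w (S.edgeCurve e s)

/-- The bending moment `B_nn = n · B · n`. -/
def Bnn (E ν ζ : ℝ) (e : Fin S.nEdge) (w : Plane → Space) (s : ℝ) : ℝ :=
  S.normal e s ⬝ᵥ S.edgeBend E ν ζ e w s *ᵥ S.normal e s

/-- The twisting moment `B_nt = n · B · t`. -/
def Bnt (E ν ζ : ℝ) (e : Fin S.nEdge) (w : Plane → Space) (s : ℝ) : ℝ :=
  S.normal e s ⬝ᵥ S.edgeBend E ν ζ e w s *ᵥ S.tangent e s

/-- The membrane part `T^(A) = A · n` of the in-plane ersatz force. -/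
def TA (E ν ζ : ℝ) (e : Fin S.nEdge) (w : Plane → Space) (s : ℝ) : Space :=
  S.memStress E ν ζ (S.edgeElem e) w (S.edgeCurve e s) *ᵥ S.normal e s

/-- The bending part `T^(B) = - b · (B · n + t B_nt)` of the in-plane ersatz force. -/
def TB (E ν ζ : ℝ) (e : Fin S.nEdge) (w : Plane → Space) (s : ℝ) : Space :=
  -(S.curvature (S.edgeElem e) (S.edgeCurve e s) *ᵥ
    (S.edgeBend E ν ζ e w s *ᵥ S.normal e s + S.Bnt E ν ζ e w s • S.tangent e s))

/-- The out-of-plane ersatz force `T_3 = (∇ · B) · n + ∂B_nt/∂t`, where `∂/∂t` is the derivative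
with respect to arc length along the edge. -/
def T3 (E ν ζ : ℝ) (e : Fin S.nEdge) (w : Plane → Space) (s : ℝ) : ℝ :=
  S.divergence (S.edgeElem e) (S.bendStress E ν ζ (S.edgeElem e) w) (S.edgeCurve e s) ⬝ᵥ
      S.normal e s +
    (S.edgeSpeed e s)⁻¹ * derivWithin (S.Bnt E ν ζ e w) (Icc 0 1) s

/-- The integral over a boundary edge with respect to arc length on the midsurface. -/
def edgeIntegral (e : Fin S.nEdge) (f : ℝ → ℝ) : ℝ := ∫ s in (0 : ℝ)..1, f s * S.edgeSpeed e s

open Classical in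
/-- The corners in the closure of the Dirichlet-1 boundary. A corner is given by the pair of the
boundary edge that ends in it and the boundary edge that starts in it; the unit tangent vector of
the boundary jumps there. -/
def dirichletCorners : Finset (Fin S.nEdge × Fin S.nEdge) :=
  Finset.univ.filter fun c => S.edgeCurve c.1 1 = S.edgeCurve c.2 0 ∧
    S.tangent c.1 1 ≠ S.tangent c.2 0 ∧ S.edgeCurve c.2 0 ∈ closure (S.ΓD 0)

/-- The jump of the twisting moment at a corner: the value just after it minus the value just
before it, in the direction of the positively oriented tangent. -/
def jumpBnt (E ν ζ : ℝ) (c : Fin S.nEdge × Fin S.nEdge) (w : Plane → Space) : ℝ :=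
  S.Bnt E ν ζ c.2 w 0 - S.Bnt E ν ζ c.1 w 1

/-- The five weighted boundary and corner forms; `C` is the trace constant in the weight. -/
def traceForm (E ν ζ C : ℝ) (w v : Plane → Space) : Fin 5 → ℝ
  | 0 => ∑ e ∈ S.dirichletEdges 0, S.edgeIntegral e fun s =>
      S.edgeSize e ^ 3 / (C * ζ ^ 3 * S.elasticityNorm E ν (S.edgeElem e) (S.edgeCurve e s)) *
        (S.T3 E ν ζ e w s * S.T3 E ν ζ e v s)
  | 1 => ∑ c ∈ S.dirichletCorners,
      S.elemSize (S.vertexElem c.2) ^ 2 /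
          (C * ζ ^ 3 * S.elasticityNorm E ν (S.vertexElem c.2) (S.edgeCurve c.2 0)) *
        (S.jumpBnt E ν ζ c w * S.jumpBnt E ν ζ c v)
  | 2 => ∑ e ∈ S.dirichletEdges 1, S.edgeIntegral e fun s =>
      S.edgeSize e / (C * ζ ^ 3 * S.elasticityNorm E ν (S.edgeElem e) (S.edgeCurve e s)) *
        (S.Bnn E ν ζ e w s * S.Bnn E ν ζ e v s)
  | 3 => ∑ e ∈ S.dirichletEdges 0, S.edgeIntegral e fun s =>
      S.edgeSize e / (C * ζ ^ 3 * S.elasticityNorm E ν (S.edgeElem e) (S.edgeCurve e s)) *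
        (S.TB E ν ζ e w s ⬝ᵥ S.TB E ν ζ e v s)
  | 4 => ∑ e ∈ S.dirichletEdges 0, S.edgeIntegral e fun s =>
      S.edgeSize e / (C * ζ * S.elasticityNorm E ν (S.edgeElem e) (S.edgeCurve e s)) *
        (S.TA E ν ζ e w s ⬝ᵥ S.TA E ν ζ e v s)

/-! ### The discrete space and the generalized eigenproblems -/

/-- A finite-dimensional space of displacement fields that are continuously differentiable up to
the boundary and piecewise polynomial or rational over the mesh. A field on the midsurface is
written as a function of the convective coordinates, set to zero outside the closed parametric
domain. -/
structure IsSplineSpace (V : Submodule ℝ (Plane → Space)) : Prop where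
  finiteDimensional : FiniteDimensional ℝ V
  support_subset : ∀ v ∈ V, ∀ p ∉ closure S.dom, v p = 0
  smooth : ∀ v ∈ V, ContDiffOn ℝ 1 v (closure S.dom)
  rational : ∀ v ∈ V, ∀ i, ∀ k : Fin 3, ∃ P Q : MvPolynomial (Fin 2) ℝ, ∀ ξ ∈ S.ref i,
    MvPolynomial.eval ξ Q ≠ 0 ∧
      v (S.chart i ξ) k = MvPolynomial.eval ξ P / MvPolynomial.eval ξ Q

/-- The rigid-body modes of a discrete space: both strains vanish. -/
def rigidModes (V : Submodule ℝ (Plane → Space)) : Set (Plane → Space) :=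
  {r | r ∈ V ∧ ∀ i, ∀ p ∈ S.cell i, S.memStrain i r p = 0 ∧ S.bendStrain i r p = 0}

/-- The `L²`-orthogonal complement of the rigid-body modes in a discrete space. -/
def rigidCompl (V : Submodule ℝ (Plane → Space)) : Set (Plane → Space) :=
  {v | v ∈ V ∧ ∀ r ∈ S.rigidModes V, S.innerL2 v r = 0}

/-- The eigenvalues of the generalized eigenproblem of a weighted boundary or corner form (with
trace constant `1`) against the strain energy form, on the orthogonal complement of the rigid-body
modes. -/
def traceEigenvalues (E ν ζ : ℝ) (V : Submodule ℝ (Plane → Space)) (k : Fin 5) : Set ℝ :=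
  {μ | ∃ u ∈ S.rigidCompl V, u ≠ 0 ∧
    ∀ w ∈ S.rigidCompl V, S.traceForm E ν ζ 1 u w k = μ * S.energy E ν ζ u w}

end ShellData

end

/-!
All forms in the theorem are symmetric, positive semidefinite and bilinear on the discrete space
`V`, which has finite dimension. This reduces both claims to linear algebra, once it is known that
each boundary form vanishes on the fields of vanishing energy.

*Linear algebra.* Let `b`, `e`, `q` be such forms on a finite-dimensional space, `b` definite, and
let `q` vanish on the null vectors of `e`. By the Cauchy–Schwarz argument for semidefinite forms,
`e` and `q` ignore `ker e`, so that they are determined by their values on the `b`-orthogonal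
complement of `ker e`. There `e` is definite, and by compactness the Rayleigh quotient `q / e` has
a maximum `μ`. At a maximizer the semidefinite form `μ e - q` vanishes, hence the maximizer is an
eigenvector for `μ`; and `μ` is the optimal constant in `q ≤ c e`
(`IsPosForm.exists_greatest_eigenvalue`, `IsPosForm.exists_bound`).

*Regularity.* An element is the diffeomorphic image of a polygon, hence compact, the closure of its
interior, and a set of unique differentiability. On it the fields of `V` are three times
continuously differentiable, as rational functions of the coordinates of the inverse chart. So the
bending stress is `C¹`, the twisting moment is `C¹` along an edge, and all integrands are continuous; in
particular all the integrals are those of integrable functions and depend linearly on each field.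

*Null vectors of the energy.* Since the elasticity tensor is positive definite on symmetric in-plane
tensors (`elasticityCoeff_quadratic`), the energy of a field vanishes only if both strains vanish on
every closed element. Then the stresses vanish there together with their derivatives from within,
and so do all the boundary and corner quantities.

*Independence of thickness and Young's modulus.* The first four forms scale like the bending energy,
by `E ζ³`, and the last one scales like the membrane energy, by `E ζ` (`traceForm_scale`). It
therefore suffices to compare each form with the respective part of the energy for `E = ζ = 1`.
-/

/-! ### Positive semidefinite forms -/

/-- A symmetric positive semidefinite bilinear form on a real vector space, as an unbundled
function of two arguments. -/
structure IsPosForm {V : Type*} [AddCommGroup V] [Module ℝ V] (b : V → V → ℝ) : Prop where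
  add_left : ∀ u v w, b (u + v) w = b u w + b v w
  smul_left : ∀ (c : ℝ) u w, b (c • u) w = c * b u w
  symm : ∀ u v, b u v = b v u
  nonneg : ∀ v, 0 ≤ b v v

namespace IsPosForm

variable {V W : Type*} [AddCommGroup V] [Module ℝ V] [AddCommGroup W] [Module ℝ W]
  {b e q : V → V → ℝ}

lemma add_right (hb : IsPosForm b) (u v w : V) : b u (v + w) = b u v + b u w := by
  rw [hb.symm, hb.add_left, hb.symm v, hb.symm w]

lemma smul_right (hb : IsPosForm b) (c : ℝ) (u w : V) : b u (c • w) = c * b u w := by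
  rw [hb.symm, hb.smul_left, hb.symm]

/-- The bundled bilinear map. -/
noncomputable def toLin (hb : IsPosForm b) : V →ₗ[ℝ] V →ₗ[ℝ] ℝ :=
  LinearMap.mk₂ ℝ b hb.add_left hb.smul_left hb.add_right hb.smul_right

/-- A null vector of a positive semidefinite form lies in its kernel. -/
lemma eq_zero_of_self_eq_zero (hb : IsPosForm b) {u : V} (hu : b u u = 0) (w : V) :
    b u w = 0 := by
  -- `b (t • u + w) (t • u + w)` is affine in `t` and bounded below, so its slope vanishes.
  by_contra h
  have h1 := hb.nonneg ((-(b w w + 1) / (2 * b u w)) • u + w)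
  rw [hb.add_left, hb.add_right, hb.add_right, hb.smul_left, hb.smul_left, hb.smul_right,
    hb.smul_right, hu, hb.symm w u] at h1
  have h2 : -(b w w + 1) / (2 * b u w) * b u w = -(b w w + 1) / 2 := by field_simp
  rw [h2] at h1
  linarith

lemma add_null_left (hb : IsPosForm b) {r : V} (hr : b r r = 0) (w : V) :
    b (r + w) (r + w) = b w w := by
  rw [hb.add_left, hb.add_right, hb.add_right, hr, hb.symm w r,
    hb.eq_zero_of_self_eq_zero hr]
  ring

lemma add (hb : IsPosForm b) (he : IsPosForm e) : IsPosForm fun u v => b u v + e u v where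
  add_left u v w := by rw [hb.add_left, he.add_left]; ring
  smul_left c u w := by rw [hb.smul_left, he.smul_left]; ring
  symm u v := by rw [hb.symm, he.symm]
  nonneg v := add_nonneg (hb.nonneg v) (he.nonneg v)

lemma const_mul (hb : IsPosForm b) {c : ℝ} (hc : 0 ≤ c) : IsPosForm fun u v => c * b u v where
  add_left u v w := by rw [hb.add_left]; ring
  smul_left a u w := by rw [hb.smul_left]; ring
  symm u v := by rw [hb.symm]
  nonneg v := mul_nonneg hc (hb.nonneg v)

lemma sum {ι : Type*} (s : Finset ι) {b : ι → V → V → ℝ} (hb : ∀ i ∈ s, IsPosForm (b i)) :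
    IsPosForm fun u v => ∑ i ∈ s, b i u v where
  add_left u v w := by
    rw [← Finset.sum_add_distrib]
    exact Finset.sum_congr rfl fun i hi => (hb i hi).add_left u v w
  smul_left c u w := by
    rw [Finset.mul_sum]
    exact Finset.sum_congr rfl fun i hi => (hb i hi).smul_left c u w
  symm u v := Finset.sum_congr rfl fun i hi => (hb i hi).symm u v
  nonneg v := Finset.sum_nonneg fun i hi => (hb i hi).nonneg v

lemma comp {b : W → W → ℝ} (hb : IsPosForm b) {f : V → W} (hf : IsLinearMap ℝ f) :
    IsPosForm fun u v => b (f u) (f v) where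
  add_left u v w := by rw [hf.map_add, hb.add_left]
  smul_left c u w := by rw [hf.map_smul, hb.smul_left]
  symm u v := hb.symm _ _
  nonneg v := hb.nonneg _

lemma mul : IsPosForm fun x y : ℝ => x * y where
  add_left := add_mul
  smul_left c u w := by simp [mul_assoc]
  symm := mul_comm
  nonneg := mul_self_nonneg

lemma dotProduct {n : ℕ} : IsPosForm fun x y : Fin n → ℝ => x ⬝ᵥ y where
  add_left := add_dotProduct
  smul_left c u w := by simp
  symm := dotProduct_comm
  nonneg v := Finset.sum_nonneg fun i _ => mul_self_nonneg (v i)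

lemma setIntegral {X : Type*} [MeasurableSpace X] {μ : Measure X} {s : Set X}
    (hs : MeasurableSet s) {b : X → V → V → ℝ} (hb : ∀ x ∈ s, IsPosForm (b x))
    (hint : ∀ u v, IntegrableOn (fun x => b x u v) s μ) :
    IsPosForm fun u v => ∫ x in s, b x u v ∂μ where
  add_left u v w := by
    rw [← integral_add (hint u w) (hint v w)]
    exact setIntegral_congr_fun hs fun x hx => (hb x hx).add_left u v w
  smul_left c u w := by
    rw [← integral_const_mul]
    exact setIntegral_congr_fun hs fun x hx => (hb x hx).smul_left c u w
  symm u v := setIntegral_congr_fun hs fun x hx => (hb x hx).symm u v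
  nonneg v := setIntegral_nonneg hs fun x hx => (hb x hx).nonneg v

lemma intervalIntegral {b : ℝ → V → V → ℝ} (hb : ∀ s ∈ Icc (0 : ℝ) 1, IsPosForm (b s))
    (hint : ∀ u v, ContinuousOn (fun s => b s u v) (Icc 0 1)) :
    IsPosForm fun u v => ∫ s in (0 : ℝ)..1, b s u v := by
  simp only [_root_.intervalIntegral.integral_of_le (zero_le_one' ℝ),
    ← integral_Icc_eq_integral_Ioc]
  exact setIntegral measurableSet_Icc hb fun u v => (hint u v).integrableOn_Icc

/-! ### The largest generalized eigenvalue -/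

/-- The inner product space structure given by a positive definite form. -/
noncomputable abbrev innerCore (hb : IsPosForm b) (hdef : ∀ v, b v v = 0 → v = 0) :
    InnerProductSpace.Core ℝ V where
  inner := b
  conj_inner_symm u v := by simpa using hb.symm v u
  re_inner_nonneg v := by simpa using hb.nonneg v
  add_left := hb.add_left
  smul_left u v c := by simpa using hb.smul_left c u v
  definite := hdef

lemma exists_add_orthogonal [FiniteDimensional ℝ V] (hb : IsPosForm b)
    (hdef : ∀ v, b v v = 0 → v = 0) (he : IsPosForm e) (v : V) :
    ∃ r w, v = r + w ∧ e r r = 0 ∧ ∀ r', e r' r' = 0 → b w r' = 0 := by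
  let core : InnerProductSpace.Core ℝ V := hb.innerCore hdef
  let _ : NormedAddCommGroup V := core.toNormedAddCommGroup
  let _ : InnerProductSpace ℝ V := InnerProductSpace.ofCore core.toCore
  let K : Submodule ℝ V := LinearMap.ker he.toLin
  have hK : ∀ r, r ∈ K ↔ e r r = 0 := fun r =>
    ⟨fun h => LinearMap.congr_fun (LinearMap.mem_ker.1 h) r,
      fun h => LinearMap.mem_ker.2 (LinearMap.ext (he.eq_zero_of_self_eq_zero h))⟩
  obtain ⟨r, hr, w, hw, rfl⟩ := K.exists_add_mem_mem_orthogonal v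
  refine ⟨r, w, rfl, (hK r).1 hr, fun r' hr' => ?_⟩
  exact (Submodule.mem_orthogonal' K w).1 hw r' ((hK r').2 hr')

/-- The Rayleigh quotient of `q` against `e` attains its maximum on the nonzero vectors of the
`b`-orthogonal complement of the kernel of `e`. -/
lemma exists_rayleigh_max [FiniteDimensional ℝ V] (hb : IsPosForm b)
    (hdef : ∀ v, b v v = 0 → v = 0) (he : IsPosForm e) (hq : IsPosForm q)
    (hne : ∃ v, (∀ r, e r r = 0 → b v r = 0) ∧ v ≠ 0) :
    ∃ u, (∀ r, e r r = 0 → b u r = 0) ∧ 0 < e u u ∧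
      ∀ w, (∀ r, e r r = 0 → b w r = 0) → q w w ≤ q u u / e u u * e w w := by
  let core : InnerProductSpace.Core ℝ V := hb.innerCore hdef
  let _ : NormedAddCommGroup V := core.toNormedAddCommGroup
  let _ : InnerProductSpace ℝ V := InnerProductSpace.ofCore core.toCore
  have hfin : ProperSpace V := FiniteDimensional.proper_real V
  have hbc : ∀ {f : V → V → ℝ}, IsPosForm f → Continuous fun v => f v v := fun {f} hf => by
    have : Continuous fun v => hf.toLin.toContinuousBilinearMap v v := by fun_prop
    exact this
  have hbr : ∀ r, Continuous fun v => b v r := fun r => by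
    have : Continuous fun v => hb.toLin.toContinuousBilinearMap v r := by fun_prop
    exact this
  let W : Set V := {v | ∀ r, e r r = 0 → b v r = 0}
  have hWc : IsClosed W := by
    simp only [W, ofPred_forall]
    exact isClosed_iInter fun r => isClosed_iInter fun _ => isClosed_eq (hbr r) continuous_const
  have hWs : ∀ (c : ℝ), ∀ v ∈ W, c • v ∈ W := fun c v hv r hr => by
    rw [hb.smul_left, hv r hr, mul_zero]
  have hWpos : ∀ v ∈ W, v ≠ 0 → 0 < e v v := fun v hv h0 =>
    (he.nonneg v).lt_of_ne fun h => h0 (hdef v (hv v h.symm))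
  have hcomp : IsCompact (Metric.sphere (0 : V) 1 ∩ W) := (isCompact_sphere _ _).inter_right hWc
  have hnorm : ∀ v ∈ W, v ≠ 0 → ‖v‖⁻¹ • v ∈ Metric.sphere (0 : V) 1 ∩ W := fun v hv h0 =>
    ⟨by simp [norm_smul, h0], hWs _ v hv⟩
  have hs0 : ∀ v ∈ Metric.sphere (0 : V) 1 ∩ W, v ≠ 0 := fun v hv =>
    Metric.ne_of_mem_sphere hv.1 one_ne_zero
  obtain ⟨v₀, hv₀, h₀⟩ := hne
  obtain ⟨u, hu, hmax⟩ := hcomp.exists_isMaxOn ⟨_, hnorm v₀ hv₀ h₀⟩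
    (f := fun v => q v v / e v v)
    ((hbc hq).continuousOn.div (hbc he).continuousOn fun v hv => (hWpos v hv.2 (hs0 v hv)).ne')
  refine ⟨u, hu.2, hWpos u hu.2 (hs0 u hu), fun w hw => ?_⟩
  by_cases hw0 : w = 0
  · have : ∀ {f : V → V → ℝ}, IsPosForm f → f 0 0 = 0 := fun hf => by
      simpa using hf.smul_left 0 0 0
    rw [hw0, this hq, this he, mul_zero]
  have h1 := hmax (hnorm w hw hw0)
  have hn : ‖w‖⁻¹ ≠ 0 := by simpa using hw0
  have h2 := hWpos w hw hw0
  simp only [mem_ofPred_eq, hq.smul_left, hq.smul_right, he.smul_left, he.smul_right] at h1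
  rw [mul_div_mul_left _ _ hn, mul_div_mul_left _ _ hn, div_le_iff₀ h2] at h1
  exact h1

/-- The maximal Rayleigh quotient on the complement of `ker e` is the largest generalized
eigenvalue, and it is the optimal constant in `q ≤ c e` on the whole space: both forms ignore
`ker e`. -/
theorem exists_greatest_eigenvalue [FiniteDimensional ℝ V] (hb : IsPosForm b)
    (hdef : ∀ v, b v v = 0 → v = 0) (he : IsPosForm e) (hq : IsPosForm q)
    (hker : ∀ v, e v v = 0 → q v v = 0)
    (hne : ∃ v, (∀ r, e r r = 0 → b v r = 0) ∧ v ≠ 0) :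
    ∃ μ, IsGreatest {μ : ℝ | ∃ u, (∀ r, e r r = 0 → b u r = 0) ∧ u ≠ 0 ∧
        ∀ w, (∀ r, e r r = 0 → b w r = 0) → q u w = μ * e u w} μ ∧ 0 ≤ μ ∧
      ∀ c, (∀ v, q v v ≤ c * e v v) ↔ μ ≤ c := by
  obtain ⟨u, hu, hpos, hmax⟩ := exists_rayleigh_max hb hdef he hq hne
  set μ := q u u / e u u with hμ
  have hall : ∀ v, q v v ≤ μ * e v v := fun v => by
    obtain ⟨r, w, rfl, hr, hw⟩ := exists_add_orthogonal hb hdef he v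
    rw [hq.add_null_left (hker r hr), he.add_null_left hr]
    exact hmax w hw
  have hu0 : u ≠ 0 := by
    rintro rfl
    have : e 0 0 = 0 := by simpa using he.smul_left 0 0 0
    exact hpos.ne' this
  have hμu : q u u = μ * e u u := by rw [hμ, div_mul_cancel₀ _ hpos.ne']
  have hle : ∀ c, (∀ v, q v v ≤ c * e v v) ↔ μ ≤ c := fun c =>
    ⟨fun h => (div_le_iff₀ hpos).2 (h u),
      fun h v => (hall v).trans (mul_le_mul_of_nonneg_right h (he.nonneg v))⟩
  -- `μ e - q` is positive semidefinite and vanishes at the maximizer `u`.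
  have hdiff : IsPosForm fun v w => μ * e v w - q v w :=
    { add_left := fun a b c => by rw [he.add_left, hq.add_left]; ring
      smul_left := fun a b c => by rw [he.smul_left, hq.smul_left]; ring
      symm := fun a b => by rw [he.symm, hq.symm]
      nonneg := fun v => sub_nonneg.2 (hall v) }
  refine ⟨μ, ⟨⟨u, hu, hu0, fun w _ => ?_⟩, ?_⟩, div_nonneg (hq.nonneg u) hpos.le, hle⟩
  · have := hdiff.eq_zero_of_self_eq_zero (u := u) (by rw [hμu, sub_self]) w
    linarith
  · rintro l ⟨v, hv, hv0, hl⟩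
    have hvpos : 0 < e v v := (he.nonneg v).lt_of_ne fun h => hv0 (hdef v (hv v h.symm))
    have h1 := hall v
    rw [hl v hv] at h1
    exact le_of_mul_le_mul_right h1 hvpos

/-- On a finite-dimensional space, `q` is bounded by a multiple of `e` as soon as it vanishes on
the null vectors of `e`. -/
theorem exists_bound [FiniteDimensional ℝ V] (hb : IsPosForm b)
    (hdef : ∀ v, b v v = 0 → v = 0) (he : IsPosForm e) (hq : IsPosForm q)
    (hker : ∀ v, e v v = 0 → q v v = 0) : ∃ c, 0 < c ∧ ∀ v, q v v ≤ c * e v v := by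
  by_cases hne : ∃ v, (∀ r, e r r = 0 → b v r = 0) ∧ v ≠ 0
  · obtain ⟨μ, -, hμ, h⟩ := exists_greatest_eigenvalue hb hdef he hq hker hne
    exact ⟨μ + 1, by positivity, (h _).2 (by linarith)⟩
  · push Not at hne
    refine ⟨1, one_pos, fun v => ?_⟩
    obtain ⟨r, w, rfl, hr, hw⟩ := exists_add_orthogonal hb hdef he v
    rw [hne w hw, add_zero, hker r hr, hr, mul_zero]

end IsPosForm

/-! ### Topology of polygons and elements -/

lemma convexHull_triangle_interior_nonempty {T : Fin 3 → Plane} (hT : AffineIndependent ℝ T) :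
    (interior (convexHull ℝ (range T))).Nonempty := by
  rw [interior_convexHull_nonempty_iff_affineSpan_eq_top,
    hT.affineSpan_eq_top_iff_card_eq_finrank_add_one]
  simp

lemma isCompact_triangle (T : Fin 3 → Plane) : IsCompact (convexHull ℝ (range T)) :=
  (finite_range T).isCompact_convexHull ℝ

namespace IsPolygon

variable {P : Set Plane} (hP : IsPolygon P)
include hP

lemma isCompact : IsCompact P := by
  obtain ⟨⟨F, -, rfl⟩, -⟩ := hP
  exact F.isCompact_biUnion fun T _ => isCompact_triangle T

lemma subset_closure_interior : P ⊆ closure (interior P) := by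
  obtain ⟨⟨F, hF, rfl⟩, -⟩ := hP
  refine iUnion₂_subset fun T hT => ?_
  have h := (convex_convexHull ℝ (range T)).closure_interior_eq_closure_of_nonempty_interior
    (convexHull_triangle_interior_nonempty (hF T hT))
  exact (subset_closure.trans h.ge).trans (closure_mono (interior_mono
    (subset_biUnion_of_mem (u := fun T : Fin 3 → Plane => convexHull ℝ (range T)) hT)))

lemma uniqueDiffOn : UniqueDiffOn ℝ P := by
  obtain ⟨⟨F, hF, rfl⟩, -⟩ := hP
  intro p hp
  obtain ⟨T, hT, hpT⟩ := mem_iUnion₂.1 hp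
  exact (uniqueDiffOn_convex (convex_convexHull ℝ _)
    (convexHull_triangle_interior_nonempty (hF T hT)) p hpT).mono
    (subset_biUnion_of_mem (u := fun T : Fin 3 → Plane => convexHull ℝ (range T)) hT)

end IsPolygon

namespace ShellData

variable {S : ShellData}

namespace IsAdmissible

variable (hS : S.IsAdmissible) (i : Fin S.nElem)
include hS

lemma cell_subset_target : S.cell i ⊆ (S.chart i).target :=
  ((S.chart i).mapsTo.mono_left (hS.ref_subset i)).image_subset

lemma isCompact_cell : IsCompact (S.cell i) :=
  (hS.polygon i).isCompact.image_of_continuousOn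
    ((S.chart i).continuousOn.mono (hS.ref_subset i))

lemma symm_mem_ref {p : Plane} (hp : p ∈ S.cell i) : (S.chart i).symm p ∈ S.ref i := by
  obtain ⟨ξ, hξ, rfl⟩ := hp
  rwa [(S.chart i).left_inv (hS.ref_subset i hξ)]

/-- The derivative of the inverse chart is a left inverse of the derivative of the chart. -/
lemma fderiv_symm_comp {ξ : Plane} (hξ : ξ ∈ (S.chart i).source) :
    (fderiv ℝ (S.chart i).symm (S.chart i ξ)).comp (fderiv ℝ (S.chart i) ξ) =
      ContinuousLinearMap.id ℝ Plane := by
  have h1 : DifferentiableAt ℝ (S.chart i) ξ :=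
    ((hS.chart_smooth i).contDiffAt ((S.chart i).open_source.mem_nhds hξ)).differentiableAt
      (by norm_num)
  have h2 : DifferentiableAt ℝ (S.chart i).symm (S.chart i ξ) :=
    ((hS.chart_symm_smooth i).contDiffAt ((S.chart i).open_target.mem_nhds
      ((S.chart i).map_source hξ))).differentiableAt (by norm_num)
  refine HasFDerivAt.unique (h2.hasFDerivAt.comp ξ h1.hasFDerivAt) ?_
  refine (hasFDerivAt_id ξ).congr_of_eventuallyEq ?_
  filter_upwards [(S.chart i).open_source.mem_nhds hξ] with η hη
  exact (S.chart i).left_inv hη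

lemma fderiv_chart_injective {ξ : Plane} (hξ : ξ ∈ (S.chart i).source) :
    Function.Injective (fderiv ℝ (S.chart i) ξ) :=
  Function.LeftInverse.injective (g := fderiv ℝ (S.chart i).symm (S.chart i ξ)) fun v =>
    DFunLike.congr_fun (hS.fderiv_symm_comp i hξ) v

lemma uniqueDiffOn_cell : UniqueDiffOn ℝ (S.cell i) := by
  refine (hS.polygon i).uniqueDiffOn.image (f' := fun ξ => fderiv ℝ (S.chart i) ξ)
    (fun ξ hξ => ?_) fun ξ hξ => ?_
  · exact (((hS.chart_smooth i).contDiffAt ((S.chart i).open_source.mem_nhds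
      (hS.ref_subset i hξ))).differentiableAt (by norm_num)).hasFDerivAt.hasFDerivWithinAt
  · have h := hS.fderiv_chart_injective i (hS.ref_subset i hξ)
    exact ((LinearMap.injective_iff_surjective
      (f := (fderiv ℝ (S.chart i) ξ : Plane →ₗ[ℝ] Plane))).1 h).denseRange

lemma cell_subset_closure_interior : S.cell i ⊆ closure (interior (S.cell i)) := by
  rintro _ ⟨ξ, hξ, rfl⟩
  have hsub : S.chart i '' interior (S.ref i) ⊆ interior (S.cell i) :=
    interior_maximal (image_mono interior_subset)
      ((S.chart i).isOpen_image_of_subset_source isOpen_interior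
        (interior_subset.trans (hS.ref_subset i)))
  exact closure_mono hsub (mem_closure_image
    ((S.chart i).continuousAt (hS.ref_subset i hξ))
    ((hS.polygon i).subset_closure_interior hξ))

lemma cell_subset_closure_dom : S.cell i ⊆ closure S.dom := by
  refine (hS.cell_subset_closure_interior i).trans (closure_mono ?_)
  rw [hS.dom_eq]
  exact interior_mono (subset_iUnion S.cell i)

omit i in
lemma closure_dom_subset : closure S.dom ⊆ ⋃ i, S.cell i := by
  refine closure_minimal ?_ (isClosed_iUnion_of_finite fun i => (hS.isCompact_cell i).isClosed)
  rw [hS.dom_eq]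
  exact interior_subset

/-- A nonnegative continuous function on an element with vanishing integral is zero, also on the
boundary of the element. -/
lemma eq_zero_of_setIntegral_eq_zero {f : Plane → ℝ} (hf : ContinuousOn f (S.cell i))
    (h0 : ∀ p ∈ S.cell i, 0 ≤ f p) (hint : ∫ p in S.cell i, f p = 0) :
    ∀ p ∈ S.cell i, f p = 0 := by
  have hm := (hS.isCompact_cell i).measurableSet
  have hae : f =ᵐ[volume.restrict (S.cell i)] 0 :=
    (setIntegral_eq_zero_iff_of_nonneg_ae
      ((ae_restrict_iff' hm).2 (Eventually.of_forall h0))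
      (hf.integrableOn_compact (hS.isCompact_cell i))).1 hint
  have hint0 : EqOn f 0 (interior (S.cell i)) :=
    Measure.eqOn_open_of_ae_eq (ae_restrict_of_ae_restrict_of_subset interior_subset hae)
      isOpen_interior (hf.mono interior_subset) continuousOn_const
  exact hint0.of_subset_closure hf continuousOn_const interior_subset
    (hS.cell_subset_closure_interior i)

/-! ### Partial derivatives on an element -/

lemma pd_contDiffOn {F : Type*} [NormedAddCommGroup F] [NormedSpace ℝ F] {m n : WithTop ℕ∞}
    {f : Plane → F} (hf : ContDiffOn ℝ n f (S.cell i)) (hmn : m + 1 ≤ n) (α : Fin 2) :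
    ContDiffOn ℝ m (S.pd i α f) (S.cell i) :=
  (hf.fderivWithin (hS.uniqueDiffOn_cell i) hmn).clm_apply contDiffOn_const

lemma notMem_closure_cell {p : Plane} (hp : p ∉ S.cell i) : p ∉ closure (S.cell i) := by
  rwa [(hS.isCompact_cell i).isClosed.closure_eq]

lemma pd_const_smul {F : Type*} [NormedAddCommGroup F] [NormedSpace ℝ F]
    (α : Fin 2) (c : ℝ) (f : Plane → F) : S.pd i α (c • f) = c • S.pd i α f := by
  funext p
  simp only [pd, Pi.smul_apply]
  by_cases hp : p ∈ S.cell i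
  · rw [fderivWithin_const_smul_field c (hS.uniqueDiffOn_cell i p hp)]
    rfl
  · simp [fderivWithin_zero_of_notMem_closure (hS.notMem_closure_cell i hp)]

/-- The partial derivative of a field that depends linearly on a parameter is linear in the
parameter. This holds at all points of the plane, since the derivative within a closed set
vanishes, by convention, off the set. -/
lemma pd_isLinearMap {F : Type*} [NormedAddCommGroup F] [NormedSpace ℝ F] {V : Type*}
    [AddCommGroup V] [Module ℝ V] {T : V → Plane → F} (hT : IsLinearMap ℝ T)
    (hd : ∀ w, DifferentiableOn ℝ (T w) (S.cell i)) (α : Fin 2) :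
    IsLinearMap ℝ fun w => S.pd i α (T w) := by
  constructor
  · intro v w
    funext p
    simp only [pd, Pi.add_apply, hT.map_add]
    by_cases hp : p ∈ S.cell i
    · rw [fderivWithin_add (hS.uniqueDiffOn_cell i p hp) (hd v p hp) (hd w p hp)]
      rfl
    · simp [fderivWithin_zero_of_notMem_closure (hS.notMem_closure_cell i hp)]
  · intro c w
    simp only [hT.map_smul, hS.pd_const_smul]

lemma fderivWithin_cell_injective {p : Plane} (hp : p ∈ S.cell i) :
    Function.Injective (fderivWithin ℝ S.x (S.cell i) p) := by
  have hp' := hS.cell_subset_closure_dom i hp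
  rw [fderivWithin_subset (hS.cell_subset_closure_dom i) (hS.uniqueDiffOn_cell i p hp)
    ((hS.x_smooth.differentiableOn (by norm_num)) p hp')]
  exact hS.x_immersion p hp'

lemma cross_cov_ne_zero {p : Plane} (hp : p ∈ S.cell i) :
    crossProduct (S.cov i 0 p) (S.cov i 1 p) ≠ 0 := by
  rw [crossProduct_ne_zero_iff_linearIndependent, LinearIndependent.pair_iff]
  intro s t hst
  have h : fderivWithin ℝ S.x (S.cell i) p ![s, t] = 0 := by
    have : (![s, t] : Plane) = s • Pi.single 0 1 + t • Pi.single 1 1 := by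
      ext j; fin_cases j <;> simp
    rw [this, map_add, map_smul, map_smul]
    exact hst
  have h2 := hS.fderivWithin_cell_injective i hp (h.trans (map_zero _).symm)
  exact ⟨congrFun h2 0, congrFun h2 1⟩

/-! ### Boundary edges -/

omit i
variable (e : Fin S.nEdge)

lemma lineMap_mem_ref {s : ℝ} (hs : s ∈ Icc (0 : ℝ) 1) :
    AffineMap.lineMap (S.edgeStart e) (S.edgeEnd e) s ∈ S.ref (S.edgeElem e) := by
  have h := hS.edge_subset e (lineMap_mem_segment ℝ _ _ hs)
  rw [← (hS.polygon (S.edgeElem e)).isCompact.isClosed.closure_eq]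
  exact frontier_subset_closure h

lemma edgeCurve_mem {s : ℝ} (hs : s ∈ Icc (0 : ℝ) 1) :
    S.edgeCurve e s ∈ S.cell (S.edgeElem e) :=
  mem_image_of_mem _ (hS.lineMap_mem_ref e hs)

lemma mapsTo_edgeCurve : MapsTo (S.edgeCurve e) (Icc 0 1) (S.cell (S.edgeElem e)) :=
  fun _ hs => hS.edgeCurve_mem e hs

lemma edgeCurve_contDiffOn : ContDiffOn ℝ 3 (S.edgeCurve e) (Icc 0 1) :=
  (hS.chart_smooth (S.edgeElem e)).comp
    (AffineMap.contDiff_lineMap (S.edgeStart e) (S.edgeEnd e)).contDiffOn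
    fun _ hs => hS.ref_subset _ (hS.lineMap_mem_ref e hs)

lemma edgeVel_ne_zero {s : ℝ} (hs : s ∈ Icc (0 : ℝ) 1) : S.edgeVel e s ≠ 0 := by
  have hu := uniqueDiffOn_Icc (zero_lt_one' ℝ) s hs
  have hsrc := hS.ref_subset _ (hS.lineMap_mem_ref e hs)
  have hchart : HasFDerivAt (S.chart (S.edgeElem e))
      (fderiv ℝ (S.chart (S.edgeElem e)) (AffineMap.lineMap (S.edgeStart e) (S.edgeEnd e) s))
      (AffineMap.lineMap (S.edgeStart e) (S.edgeEnd e) s) :=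
    (((hS.chart_smooth _).contDiffAt ((S.chart _).open_source.mem_nhds
      hsrc)).differentiableAt (by norm_num)).hasFDerivAt
  have hγ := hchart.comp_hasDerivWithinAt s
    (AffineMap.hasDerivWithinAt_lineMap (a := S.edgeStart e) (b := S.edgeEnd e) (s := Icc 0 1))
  have hx := ((hS.x_smooth_cell (S.edgeElem e)).differentiableOn (by norm_num) _
    (hS.edgeCurve_mem e hs)).hasFDerivWithinAt
  have h := (hx.comp_hasDerivWithinAt s hγ (hS.mapsTo_edgeCurve e)).derivWithin hu
  have h' : S.edgeVel e s = _ := h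
  rw [h']
  intro h0
  have h1 := hS.fderivWithin_cell_injective _ (hS.edgeCurve_mem e hs) (h0.trans (map_zero _).symm)
  have h2 := hS.fderiv_chart_injective _ hsrc (h1.trans (map_zero _).symm)
  exact hS.edge_ne e (sub_eq_zero.1 h2).symm

end IsAdmissible

end ShellData

namespace ShellData

/-! ### The elasticity tensor at a point -/

/-- The quadratic form of the elasticity coefficients as a sum of squares, obtained from the
Cholesky factorization of the contravariant metric `G`. -/
lemma elasticityCoeff_quadratic (E ν : ℝ) {G : Matrix (Fin 2) (Fin 2) ℝ} (hG : G 1 0 = G 0 1)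
    (h0 : G 0 0 ≠ 0) (m : Matrix (Fin 2) (Fin 2) ℝ) :
    ∑ α, ∑ β, ∑ κ, ∑ μ, elasticityCoeff E ν G α β κ μ * m κ μ * m α β =
      E / (2 * (1 + ν)) * (2 / G 0 0 ^ 2 *
        ((G 0 0 ^ 2 * m 0 0 + G 0 0 * G 0 1 * (m 0 1 + m 1 0) + G 0 1 ^ 2 * m 1 1) ^ 2 +
          2 * G.det * (G 0 0 * ((m 0 1 + m 1 0) / 2) + G 0 1 * m 1 1) ^ 2 +
          (G.det * m 1 1) ^ 2) +
        2 * ν / (1 - ν) * (G 0 0 * m 0 0 + G 0 1 * (m 0 1 + m 1 0) + G 1 1 * m 1 1) ^ 2) := by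
  simp only [elasticityCoeff, Fin.sum_univ_two, hG, det_fin_two]
  generalize 2 * ν / (1 - ν) = k
  generalize E / (2 * (1 + ν)) = c
  field_simp
  ring

lemma elasticityCoeff_isPosForm {E ν : ℝ} (hE : 0 < E) (hν₀ : 0 ≤ ν) (hν₁ : ν ≤ 1 / 2)
    {G : Matrix (Fin 2) (Fin 2) ℝ} (hG : G 1 0 = G 0 1) (h0 : 0 < G 0 0) (hdet : 0 < G.det) :
    IsPosForm fun m n : Matrix (Fin 2) (Fin 2) ℝ =>
      ∑ α, ∑ β, ∑ κ, ∑ μ, elasticityCoeff E ν G α β κ μ * m κ μ * n α β where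
  add_left u v w := by simp only [Matrix.add_apply, mul_add, add_mul, Finset.sum_add_distrib]
  smul_left c u w := by
    simp only [Matrix.smul_apply, smul_eq_mul, Finset.mul_sum]
    refine Finset.sum_congr rfl fun _ _ => Finset.sum_congr rfl fun _ _ =>
      Finset.sum_congr rfl fun _ _ => Finset.sum_congr rfl fun _ _ => by ring
  symm u v := by
    simp only [elasticityCoeff, Fin.sum_univ_two, hG]
    ring
  nonneg m := by
    have h1 : 0 < 1 - ν := by linarith
    rw [elasticityCoeff_quadratic E ν hG h0.ne']
    positivity

lemma elasticityCoeff_definite {E ν : ℝ} (hE : 0 < E) (hν₀ : 0 ≤ ν) (hν₁ : ν ≤ 1 / 2)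
    {G : Matrix (Fin 2) (Fin 2) ℝ} (hG : G 1 0 = G 0 1) (h0 : 0 < G 0 0) (hdet : 0 < G.det)
    {m : Matrix (Fin 2) (Fin 2) ℝ} (hm : m 1 0 = m 0 1)
    (h : ∑ α, ∑ β, ∑ κ, ∑ μ, elasticityCoeff E ν G α β κ μ * m κ μ * m α β = 0) : m = 0 := by
  have h1 : 0 < 1 - ν := by linarith
  rw [elasticityCoeff_quadratic E ν hG h0.ne', hm] at h
  set s := G 0 0 ^ 2 * m 0 0 + G 0 0 * G 0 1 * (m 0 1 + m 0 1) + G 0 1 ^ 2 * m 1 1 with hs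
  set t := G 0 0 * ((m 0 1 + m 0 1) / 2) + G 0 1 * m 1 1 with ht
  have hc : 0 < E / (2 * (1 + ν)) := by positivity
  have hk : 0 ≤ 2 * ν / (1 - ν) *
      (G 0 0 * m 0 0 + G 0 1 * (m 0 1 + m 0 1) + G 1 1 * m 1 1) ^ 2 := by positivity
  have hsum : s ^ 2 + 2 * G.det * t ^ 2 + (G.det * m 1 1) ^ 2 = 0 := by
    have h2 := (mul_eq_zero.1 h).resolve_left hc.ne'
    have h3 : 0 < 2 / G 0 0 ^ 2 := by positivity
    have h4 : 0 ≤ s ^ 2 + 2 * G.det * t ^ 2 + (G.det * m 1 1) ^ 2 := by positivity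
    by_contra h5
    have h6 := mul_pos h3 (h4.lt_of_ne (Ne.symm h5))
    linarith
  have a1 : 0 ≤ s ^ 2 := by positivity
  have a2 : 0 ≤ 2 * G.det * t ^ 2 := by positivity
  have a3 : 0 ≤ (G.det * m 1 1) ^ 2 := by positivity
  have e3 : m 1 1 = 0 := by
    have : (G.det * m 1 1) ^ 2 = 0 := by linarith
    simpa [hdet.ne'] using this
  have e2 : m 0 1 = 0 := by
    have : 2 * G.det * t ^ 2 = 0 := by linarith
    simpa [hdet.ne', ht, e3, h0.ne'] using this
  have e1 : m 0 0 = 0 := by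
    have : s ^ 2 = 0 := by linarith
    simpa [hs, e3, e2, h0.ne'] using this
  ext a b
  fin_cases a <;> fin_cases b <;> simp [e1, e2, e3, hm]

/-- For a symmetric invertible metric, `ℂ^{αβλμ} ℂ_{αβλμ}` does not depend on the metric. -/
lemma elasticityCoeff_contract (E ν : ℝ) {g : Matrix (Fin 2) (Fin 2) ℝ} (hg : g 1 0 = g 0 1)
    (hdet : g.det ≠ 0) :
    ∑ α, ∑ β, ∑ κ, ∑ μ, elasticityCoeff E ν g⁻¹ α β κ μ * elasticityCoeff E ν g α β κ μ =
      (E / (2 * (1 + ν))) ^ 2 *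
        (12 + 8 * (2 * ν / (1 - ν)) + 4 * (2 * ν / (1 - ν)) ^ 2) := by
  simp only [elasticityCoeff, Fin.sum_univ_two, Matrix.inv_def, adjugate_fin_two,
    Ring.inverse_eq_inv', Matrix.smul_apply, smul_eq_mul, Matrix.of_apply,
    Matrix.cons_val', Matrix.cons_val_zero, Matrix.cons_val_one, Matrix.cons_val_fin_one, hg]
  generalize 2 * ν / (1 - ν) = k
  generalize E / (2 * (1 + ν)) = c
  have hd : g.det = g 0 0 * g 1 1 - g 0 1 * g 0 1 := by rw [det_fin_two, hg]
  have hI : g.det⁻¹ * (g 0 0 * g 1 1 - g 0 1 * g 0 1) = 1 := by rw [← hd, inv_mul_cancel₀ hdet]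
  generalize g.det⁻¹ = I at hI ⊢
  linear_combination c ^ 2 * (12 + 8 * k + 4 * k ^ 2) *
    (I * (g 0 0 * g 1 1 - g 0 1 * g 0 1) + 1) * hI

lemma elasticityCoeff_scale (E ν : ℝ) (G : Matrix (Fin 2) (Fin 2) ℝ) (α β κ μ : Fin 2) :
    elasticityCoeff E ν G α β κ μ = E * elasticityCoeff 1 ν G α β κ μ := by
  simp only [elasticityCoeff]
  ring

lemma ddot_vecMulVec (u v : Space) (N : Tensor) :
    Tensor.ddot (vecMulVec u v) N = u ⬝ᵥ N *ᵥ v := by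
  simp only [Tensor.ddot, vecMulVec_apply, dotProduct, mulVec, Finset.mul_sum]
  exact Finset.sum_congr rfl fun _ _ => Finset.sum_congr rfl fun _ _ => by ring

lemma ddot_smul_left (c : ℝ) (M N : Tensor) : Tensor.ddot (c • M) N = c * Tensor.ddot M N := by
  simp only [Tensor.ddot, Matrix.smul_apply, smul_eq_mul, Finset.mul_sum, mul_assoc]

lemma ddot_sum_left {ι : Type*} (s : Finset ι) (M : ι → Tensor) (N : Tensor) :
    Tensor.ddot (∑ k ∈ s, M k) N = ∑ k ∈ s, Tensor.ddot (M k) N := by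
  simp only [Tensor.ddot, Matrix.sum_apply, Finset.sum_mul]
  rw [Finset.sum_comm_cycle]

variable {S : ShellData} {i : Fin S.nElem} {p : Plane}

lemma metric_symm : S.metric i p 1 0 = S.metric i p 0 1 := by
  simp [metric, dotProduct_comm]

lemma metric_det : (S.metric i p).det =
    crossProduct (S.cov i 0 p) (S.cov i 1 p) ⬝ᵥ crossProduct (S.cov i 0 p) (S.cov i 1 p) := by
  rw [cross_dot_cross, det_fin_two, metric_symm]
  simp [metric, dotProduct_comm]

/-- The components `a_κ · M a_μ` of a tensor along the surface. -/
noncomputable def components (S : ShellData) (i : Fin S.nElem) (p : Plane) (M : Tensor) :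
    Matrix (Fin 2) (Fin 2) ℝ :=
  Matrix.of fun κ μ => S.cov i κ p ⬝ᵥ M *ᵥ S.cov i μ p

lemma components_isLinearMap : IsLinearMap ℝ (S.components i p) where
  map_add M N := by
    ext κ μ
    simp [components, add_mulVec]
  map_smul c M := by
    ext κ μ
    simp [components, smul_mulVec]

lemma ddot_elasticity (E ν : ℝ) (M N : Tensor) :
    Tensor.ddot (S.elasticity E ν i p M) N = ∑ α, ∑ β, ∑ κ, ∑ μ,
      elasticityCoeff E ν (S.metric i p)⁻¹ α β κ μ * S.components i p M κ μ *
        S.components i p N α β := by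
  simp only [elasticity, ddot_sum_left, ddot_smul_left, ddot_vecMulVec, components, of_apply]

lemma elasticity_isLinearMap (E ν : ℝ) : IsLinearMap ℝ (S.elasticity E ν i p) where
  map_add M N := by
    simp only [elasticity, add_mulVec, dotProduct_add, mul_add, add_smul, Finset.sum_add_distrib]
  map_smul c M := by
    simp only [elasticity, smul_mulVec, dotProduct_smul, Finset.smul_sum, smul_smul, smul_eq_mul,
      mul_left_comm c]

lemma elasticity_scale (E ν : ℝ) (M : Tensor) :
    S.elasticity E ν i p M = E • S.elasticity 1 ν i p M := by
  simp only [elasticity, elasticityCoeff_scale E, Finset.smul_sum, smul_smul, mul_assoc]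

lemma length_ne_zero {v : Space} (hv : v ≠ 0) : Space.length v ≠ 0 := by
  have h : 0 < v ⬝ᵥ v :=
    (IsPosForm.dotProduct.nonneg v).lt_of_ne fun h => hv (dotProduct_self_eq_zero.1 h.symm)
  exact (Real.sqrt_pos.2 h).ne'

lemma length_mul_length (v : Space) : Space.length v * Space.length v = v ⬝ᵥ v :=
  Real.mul_self_sqrt (IsPosForm.dotProduct.nonneg v)

lemma memStrain_transpose (w : Plane → Space) : (S.memStrain i w p)ᵀ = S.memStrain i w p := by
  simp only [memStrain, proj, Tensor.sym, transpose_mul, transpose_sub, transpose_one,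
    transpose_vecMulVec, transpose_smul, transpose_add, transpose_transpose, Matrix.mul_assoc,
    add_comm]

lemma bendStrain_transpose (w : Plane → Space) : (S.bendStrain i w p)ᵀ = S.bendStrain i w p := by
  simp only [bendStrain, proj, Tensor.sym, transpose_mul, transpose_sub, transpose_one,
    transpose_vecMulVec, transpose_smul, transpose_add, transpose_transpose, Matrix.mul_assoc,
    transpose_neg, add_comm]

lemma inv_metric_symm : (S.metric i p)⁻¹ 1 0 = (S.metric i p)⁻¹ 0 1 := by
  simp [Matrix.inv_def, adjugate_fin_two, metric_symm]

namespace IsAdmissible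

variable (hS : S.IsAdmissible) (hp : p ∈ S.cell i)
include hS hp

lemma metric_det_pos : 0 < (S.metric i p).det := by
  rw [metric_det]
  exact (IsPosForm.dotProduct.nonneg _).lt_of_ne fun h =>
    hS.cross_cov_ne_zero i hp (dotProduct_self_eq_zero.1 h.symm)

lemma areaDensity_pos : 0 < S.areaDensity i p := Real.sqrt_pos.2 (hS.metric_det_pos hp)

lemma inv_metric_pos : 0 < (S.metric i p)⁻¹ 0 0 := by
  have hd := hS.metric_det_pos hp
  have h1 : 0 < S.metric i p 1 1 := by
    refine (IsPosForm.dotProduct.nonneg (S.cov i 1 p)).lt_of_ne fun h => ?_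
    have h2 : S.cov i 1 p = 0 := dotProduct_self_eq_zero.1 h.symm
    exact hS.cross_cov_ne_zero i hp (by rw [h2, map_zero])
  simp only [Matrix.inv_def, adjugate_fin_two, Ring.inverse_eq_inv', Matrix.smul_apply, of_apply,
    cons_val', cons_val_zero, cons_val_fin_one, smul_eq_mul]
  positivity

lemma inv_metric_det_pos : 0 < (S.metric i p)⁻¹.det := by
  rw [det_nonsing_inv, Ring.inverse_eq_inv']
  exact inv_pos.2 (hS.metric_det_pos hp)

lemma elasticityNorm_eq (E ν : ℝ) : S.elasticityNorm E ν i p =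
    √((E / (2 * (1 + ν))) ^ 2 * (12 + 8 * (2 * ν / (1 - ν)) + 4 * (2 * ν / (1 - ν)) ^ 2)) := by
  rw [elasticityNorm, elasticityCoeff_contract E ν metric_symm (hS.metric_det_pos hp).ne']

lemma ddot_elasticity_isPosForm {E ν : ℝ} (hE : 0 < E) (hν₀ : 0 ≤ ν) (hν₁ : ν ≤ 1 / 2) :
    IsPosForm fun M N : Tensor => Tensor.ddot (S.elasticity E ν i p M) N := by
  simp only [ddot_elasticity]
  exact (elasticityCoeff_isPosForm hE hν₀ hν₁ inv_metric_symm (hS.inv_metric_pos hp)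
    (hS.inv_metric_det_pos hp)).comp components_isLinearMap

lemma director_dot_director : S.director i p ⬝ᵥ S.director i p = 1 := by
  have h := length_ne_zero (hS.cross_cov_ne_zero i hp)
  rw [director, smul_dotProduct, dotProduct_smul, ← length_mul_length, smul_eq_mul, smul_eq_mul]
  field_simp

lemma director_vecMul_proj : S.director i p ᵥ* S.proj i p = 0 := by
  rw [proj, vecMul_sub, vecMul_one, vecMul_vecMulVec, hS.director_dot_director hp]
  simp

/-- A tensor that annihilates the director from both sides is determined by its components along
the surface. -/
lemma eq_zero_of_components_eq_zero {N : Tensor} (hl : S.director i p ᵥ* N = 0)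
    (hr : N *ᵥ S.director i p = 0) (h : S.components i p N = 0) : N = 0 := by
  -- `A` has the basis vectors `a_1, a_2, a_3` as rows.
  let A : Tensor := Matrix.of ![S.director i p, S.cov i 0 p, S.cov i 1 p]
  have hA : A.det ≠ 0 := by
    change Matrix.det ![S.director i p, S.cov i 0 p, S.cov i 1 p] ≠ 0
    rw [← triple_product_eq_det, director, smul_dotProduct, ← length_mul_length, smul_eq_mul]
    have := length_ne_zero (hS.cross_cov_ne_zero i hp)
    field_simp
    exact this
  have hz : A * N * Aᵀ = 0 := by
    have hent : ∀ j k, (A * N * Aᵀ) j k = A.row j ⬝ᵥ N *ᵥ A.row k := fun j k => by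
      rw [Matrix.mul_assoc, mul_apply_eq_vecMul, vecMul_eq_sum]
      simp [Matrix.mul_apply, dotProduct, mulVec, row]
    ext j k
    rw [hent]
    have hcomp : ∀ κ μ, S.cov i κ p ⬝ᵥ N *ᵥ S.cov i μ p = 0 := fun κ μ =>
      congrFun (congrFun h κ) μ
    have hl' : ∀ v, S.director i p ⬝ᵥ N *ᵥ v = 0 := fun v => by
      rw [dotProduct_mulVec, hl, zero_dotProduct]
    have hr' : ∀ v, v ⬝ᵥ N *ᵥ S.director i p = 0 := fun v => by rw [hr, dotProduct_zero]
    fin_cases j <;> fin_cases k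
    · exact hl' _
    · exact hl' _
    · exact hl' _
    · exact hr' _
    · exact hcomp 0 0
    · exact hcomp 0 1
    · exact hr' _
    · exact hcomp 1 0
    · exact hcomp 1 1
  have hAu : IsUnit A := (Matrix.isUnit_iff_isUnit_det A).2 (isUnit_iff_ne_zero.2 hA)
  have hAt : IsUnit Aᵀ := (Matrix.isUnit_iff_isUnit_det _).2
    (by rw [det_transpose]; exact isUnit_iff_ne_zero.2 hA)
  exact (hAu.mul_right_eq_zero).1 ((hAt.mul_left_eq_zero).1 hz)

/-- The elastic energy density is definite on symmetric in-plane tensors. -/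
lemma eq_zero_of_ddot_elasticity {E ν : ℝ} (hE : 0 < E) (hν₀ : 0 ≤ ν) (hν₁ : ν ≤ 1 / 2)
    {N : Tensor} (hN : Nᵀ = N) (hl : S.director i p ᵥ* N = 0)
    (h : Tensor.ddot (S.elasticity E ν i p N) N = 0) : N = 0 := by
  have hr : N *ᵥ S.director i p = 0 := by rw [← hN, mulVec_transpose, hl]
  refine hS.eq_zero_of_components_eq_zero hp hl hr ?_
  rw [ddot_elasticity] at h
  refine elasticityCoeff_definite hE hν₀ hν₁ inv_metric_symm (hS.inv_metric_pos hp)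
    (hS.inv_metric_det_pos hp) ?_ h
  simp only [components, of_apply]
  rw [dotProduct_mulVec, ← mulVec_transpose, hN, dotProduct_comm]

lemma memStrain_eq_zero {E ν : ℝ} (hE : 0 < E) (hν₀ : 0 ≤ ν) (hν₁ : ν ≤ 1 / 2)
    {w : Plane → Space}
    (h : Tensor.ddot (S.elasticity E ν i p (S.memStrain i w p)) (S.memStrain i w p) = 0) :
    S.memStrain i w p = 0 := by
  refine hS.eq_zero_of_ddot_elasticity hp hE hν₀ hν₁ (memStrain_transpose w) ?_ h
  rw [memStrain, Matrix.mul_assoc, ← vecMul_vecMul, hS.director_vecMul_proj hp, zero_vecMul]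

lemma bendStrain_eq_zero {E ν : ℝ} (hE : 0 < E) (hν₀ : 0 ≤ ν) (hν₁ : ν ≤ 1 / 2)
    {w : Plane → Space}
    (h : Tensor.ddot (S.elasticity E ν i p (S.bendStrain i w p)) (S.bendStrain i w p) = 0) :
    S.bendStrain i w p = 0 := by
  refine hS.eq_zero_of_ddot_elasticity hp hE hν₀ hν₁ (bendStrain_transpose w) ?_ h
  rw [bendStrain, Matrix.mul_assoc, vecMul_neg, ← vecMul_vecMul, hS.director_vecMul_proj hp,
    zero_vecMul, neg_zero]

end IsAdmissible

end ShellData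

/-! ### Smooth vector and tensor fields -/

section Fields

variable {X : Type*} [NormedAddCommGroup X] [NormedSpace ℝ X] {n : WithTop ℕ∞} {s : Set X}

/-- A tensor field is `n` times continuously differentiable on a set if all its entries are. -/
def TensorContDiffOn (n : WithTop ℕ∞) (T : X → Tensor) (s : Set X) : Prop :=
  ∀ j k, ContDiffOn ℝ n (fun p => T p j k) s

lemma ContDiffOn.dotProduct {m : ℕ} {f g : X → Fin m → ℝ} (hf : ContDiffOn ℝ n f s)
    (hg : ContDiffOn ℝ n g s) : ContDiffOn ℝ n (fun p => f p ⬝ᵥ g p) s :=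
  ContDiffOn.sum fun k _ => (contDiffOn_pi.1 hf k).mul (contDiffOn_pi.1 hg k)

lemma ContDiffOn.crossProduct {f g : X → Space} (hf : ContDiffOn ℝ n f s)
    (hg : ContDiffOn ℝ n g s) : ContDiffOn ℝ n (fun p => crossProduct (f p) (g p)) s := by
  have hf' := contDiffOn_pi.1 hf
  have hg' := contDiffOn_pi.1 hg
  refine contDiffOn_pi.2 fun k => ?_
  simp only [cross_apply]
  fin_cases k
  · exact ((hf' 1).mul (hg' 2)).sub ((hf' 2).mul (hg' 1))
  · exact ((hf' 2).mul (hg' 0)).sub ((hf' 0).mul (hg' 2))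
  · exact ((hf' 0).mul (hg' 1)).sub ((hf' 1).mul (hg' 0))

lemma ContDiffOn.length {f : X → Space} (hf : ContDiffOn ℝ n f s) (h0 : ∀ p ∈ s, f p ≠ 0) :
    ContDiffOn ℝ n (fun p => Space.length (f p)) s :=
  (hf.dotProduct hf).sqrt fun p hp h => h0 p hp (dotProduct_self_eq_zero.1 h)

namespace TensorContDiffOn

variable {T U : X → Tensor}

lemma of_le {m : WithTop ℕ∞} (hT : TensorContDiffOn n T s) (h : m ≤ n) :
    TensorContDiffOn m T s := fun j k => (hT j k).of_le h

lemma const (M : Tensor) : TensorContDiffOn n (fun _ : X => M) s := fun _ _ => contDiffOn_const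

lemma sub (hT : TensorContDiffOn n T s) (hU : TensorContDiffOn n U s) :
    TensorContDiffOn n (fun p => T p - U p) s := fun j k => (hT j k).sub (hU j k)

lemma neg (hT : TensorContDiffOn n T s) : TensorContDiffOn n (fun p => -T p) s :=
  fun j k => (hT j k).neg

lemma smul {c : X → ℝ} (hc : ContDiffOn ℝ n c s) (hT : TensorContDiffOn n T s) :
    TensorContDiffOn n (fun p => c p • T p) s := fun j k => hc.mul (hT j k)

lemma mul (hT : TensorContDiffOn n T s) (hU : TensorContDiffOn n U s) :
    TensorContDiffOn n (fun p => T p * U p) s := fun j k => by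
  simp only [Matrix.mul_apply]
  exact ContDiffOn.sum fun l _ => (hT j l).mul (hU l k)

lemma sym (hT : TensorContDiffOn n T s) : TensorContDiffOn n (fun p => Tensor.sym (T p)) s :=
  fun j k => contDiffOn_const.mul ((hT j k).add (hT k j))

lemma sum {ι : Type*} {F : Finset ι} {T : ι → X → Tensor}
    (hT : ∀ a ∈ F, TensorContDiffOn n (T a) s) :
    TensorContDiffOn n (fun p => ∑ a ∈ F, T a p) s := fun j k => by
  simp only [Matrix.sum_apply]
  exact ContDiffOn.sum fun a ha => hT a ha j k

lemma vecMulVec {f g : X → Space} (hf : ContDiffOn ℝ n f s) (hg : ContDiffOn ℝ n g s) :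
    TensorContDiffOn n (fun p => vecMulVec (f p) (g p)) s :=
  fun j k => (contDiffOn_pi.1 hf j).mul (contDiffOn_pi.1 hg k)

lemma mulVec {f : X → Space} (hT : TensorContDiffOn n T s) (hf : ContDiffOn ℝ n f s) :
    ContDiffOn ℝ n (fun p => T p *ᵥ f p) s :=
  contDiffOn_pi.2 fun j => ContDiffOn.dotProduct (contDiffOn_pi.2 (hT j)) hf

lemma vecMul {f : X → Space} (hT : TensorContDiffOn n T s) (hf : ContDiffOn ℝ n f s) :
    ContDiffOn ℝ n (fun p => f p ᵥ* T p) s :=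
  contDiffOn_pi.2 fun k => ContDiffOn.dotProduct hf (contDiffOn_pi.2 fun j => hT j k)

lemma ddot (hT : TensorContDiffOn n T s) (hU : TensorContDiffOn n U s) :
    ContDiffOn ℝ n (fun p => Tensor.ddot (T p) (U p)) s :=
  ContDiffOn.sum fun j _ => ContDiffOn.sum fun k _ => (hT j k).mul (hU j k)

lemma comp {Y : Type*} [NormedAddCommGroup Y] [NormedSpace ℝ Y] {γ : Y → X} {t : Set Y}
    (hT : TensorContDiffOn n T s) (hγ : ContDiffOn ℝ n γ t) (h : MapsTo γ t s) :
    TensorContDiffOn n (fun r => T (γ r)) t := fun j k => (hT j k).comp hγ h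

end TensorContDiffOn

end Fields

lemma MvPolynomial.contDiff_eval {σ : Type*} [Fintype σ] (P : MvPolynomial σ ℝ)
    {n : WithTop ℕ∞} : ContDiff ℝ n fun x : σ → ℝ => MvPolynomial.eval x P := by
  induction P using MvPolynomial.induction_on with
  | C a => simpa using contDiff_const
  | add p q hp hq => simpa using hp.add hq
  | mul_X p k hp => simpa using hp.mul (contDiff_apply ℝ ℝ k)

namespace ShellData

variable {S : ShellData}

namespace IsAdmissible

variable (hS : S.IsAdmissible) (i : Fin S.nElem)
include hS

/-! ### Regularity of the geometry and of the stresses on an element -/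

lemma cov_contDiffOn (α : Fin 2) : ContDiffOn ℝ 2 (S.cov i α) (S.cell i) :=
  hS.pd_contDiffOn i (hS.x_smooth_cell i) (by norm_num) α

lemma metric_contDiffOn (α β : Fin 2) :
    ContDiffOn ℝ 2 (fun p => S.metric i p α β) (S.cell i) :=
  (hS.cov_contDiffOn i α).dotProduct (hS.cov_contDiffOn i β)

lemma metric_det_contDiffOn : ContDiffOn ℝ 2 (fun p => (S.metric i p).det) (S.cell i) := by
  simp only [det_fin_two]
  exact ((hS.metric_contDiffOn i 0 0).mul (hS.metric_contDiffOn i 1 1)).sub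
    ((hS.metric_contDiffOn i 0 1).mul (hS.metric_contDiffOn i 1 0))

lemma inv_metric_contDiffOn (α β : Fin 2) :
    ContDiffOn ℝ 2 (fun p => (S.metric i p)⁻¹ α β) (S.cell i) := by
  have hd := (hS.metric_det_contDiffOn i).inv fun p hp => (hS.metric_det_pos hp).ne'
  simp only [Matrix.inv_def, adjugate_fin_two, Ring.inverse_eq_inv']
  fin_cases α <;> fin_cases β
  · exact hd.mul (hS.metric_contDiffOn i 1 1)
  · exact hd.mul (hS.metric_contDiffOn i 0 1).neg
  · exact hd.mul (hS.metric_contDiffOn i 1 0).neg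
  · exact hd.mul (hS.metric_contDiffOn i 0 0)

lemma con_contDiffOn (α : Fin 2) : ContDiffOn ℝ 2 (S.con i α) (S.cell i) :=
  ContDiffOn.sum fun μ _ => (hS.inv_metric_contDiffOn i α μ).smul (hS.cov_contDiffOn i μ)

lemma director_contDiffOn : ContDiffOn ℝ 2 (S.director i) (S.cell i) := by
  have hc := (hS.cov_contDiffOn i 0).crossProduct (hS.cov_contDiffOn i 1)
  exact ((hc.length fun p hp => hS.cross_cov_ne_zero i hp).inv
    fun p hp => length_ne_zero (hS.cross_cov_ne_zero i hp)).smul hc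

lemma areaDensity_continuousOn : ContinuousOn (S.areaDensity i) (S.cell i) :=
  (hS.metric_det_contDiffOn i).continuousOn.sqrt

lemma proj_contDiffOn : TensorContDiffOn 2 (S.proj i) (S.cell i) :=
  (TensorContDiffOn.const 1).sub
    (TensorContDiffOn.vecMulVec (hS.director_contDiffOn i) (hS.director_contDiffOn i))

lemma curvature_contDiffOn : TensorContDiffOn 1 (S.curvature i) (S.cell i) :=
  TensorContDiffOn.sum fun α _ => TensorContDiffOn.sum fun β _ =>
    TensorContDiffOn.smul
      (((hS.director_contDiffOn i).of_le (by norm_num)).dotProduct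
        (hS.pd_contDiffOn i (hS.cov_contDiffOn i α) (by norm_num) β))
      (TensorContDiffOn.vecMulVec ((hS.con_contDiffOn i α).of_le (by norm_num))
        ((hS.con_contDiffOn i β).of_le (by norm_num)))

lemma pdTensor_contDiffOn {m n : WithTop ℕ∞} {T : Plane → Tensor}
    (hT : TensorContDiffOn n T (S.cell i)) (hmn : m + 1 ≤ n) (α : Fin 2) :
    TensorContDiffOn m (S.pdTensor i α T) (S.cell i) :=
  fun j k => hS.pd_contDiffOn i (hT j k) hmn α

lemma elasticity_contDiffOn {n : WithTop ℕ∞} (hn : n ≤ 2) (E ν : ℝ) {T : Plane → Tensor}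
    (hT : TensorContDiffOn n T (S.cell i)) :
    TensorContDiffOn n (fun p => S.elasticity E ν i p (T p)) (S.cell i) := by
  have hc : ∀ α, ContDiffOn ℝ n (S.cov i α) (S.cell i) := fun α =>
    (hS.cov_contDiffOn i α).of_le hn
  have hg : ∀ α β, ContDiffOn ℝ n (fun p => (S.metric i p)⁻¹ α β) (S.cell i) := fun α β =>
    (hS.inv_metric_contDiffOn i α β).of_le hn
  refine TensorContDiffOn.sum fun α _ => TensorContDiffOn.sum fun β _ =>
    TensorContDiffOn.sum fun κ _ => TensorContDiffOn.sum fun μ _ =>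
      TensorContDiffOn.smul (ContDiffOn.mul ?_ ((hc κ).dotProduct (hT.mulVec (hc μ))))
        (TensorContDiffOn.vecMulVec (hc α) (hc β))
  exact contDiffOn_const.mul ((((hg α κ).mul (hg β μ)).add ((hg α μ).mul (hg β κ))).add
    (contDiffOn_const.mul ((hg α β).mul (hg κ μ))))

section Field

variable {i} {w : Plane → Space} (hw : ContDiffOn ℝ 3 w (S.cell i))
include hw

lemma grad_contDiffOn : TensorContDiffOn 2 (S.grad i w) (S.cell i) :=
  TensorContDiffOn.sum fun κ _ => TensorContDiffOn.vecMulVec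
    (hS.pd_contDiffOn i hw (by norm_num) κ) (hS.con_contDiffOn i κ)

lemma normalHessian_contDiffOn : TensorContDiffOn 1 (S.normalHessian i w) (S.cell i) :=
  TensorContDiffOn.sum fun μ _ => TensorContDiffOn.vecMulVec
    ((hS.pdTensor_contDiffOn i (hS.grad_contDiffOn hw) (by norm_num) μ).vecMul
      ((hS.director_contDiffOn i).of_le (by norm_num)))
    ((hS.con_contDiffOn i μ).of_le (by norm_num))

lemma memStrain_contDiffOn : TensorContDiffOn 2 (S.memStrain i w) (S.cell i) :=
  ((hS.proj_contDiffOn i).mul (hS.grad_contDiffOn hw).sym).mul (hS.proj_contDiffOn i)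

lemma bendStrain_contDiffOn : TensorContDiffOn 1 (S.bendStrain i w) (S.cell i) :=
  ((((hS.proj_contDiffOn i).of_le (by norm_num)).mul (hS.normalHessian_contDiffOn hw).sym).mul
    ((hS.proj_contDiffOn i).of_le (by norm_num))).neg

lemma memStress_contDiffOn (E ν ζ : ℝ) :
    TensorContDiffOn 2 (S.memStress E ν ζ i w) (S.cell i) :=
  TensorContDiffOn.smul contDiffOn_const
    (hS.elasticity_contDiffOn i le_rfl E ν (hS.memStrain_contDiffOn hw))

lemma bendStress_contDiffOn (E ν ζ : ℝ) :
    TensorContDiffOn 1 (S.bendStress E ν ζ i w) (S.cell i) :=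
  TensorContDiffOn.smul contDiffOn_const
    (hS.elasticity_contDiffOn i (by norm_num) E ν (hS.bendStrain_contDiffOn hw))

lemma divergence_continuousOn (E ν ζ : ℝ) :
    ContinuousOn (S.divergence i (S.bendStress E ν ζ i w)) (S.cell i) := by
  have h : ContDiffOn ℝ 0 (S.divergence i (S.bendStress E ν ζ i w)) (S.cell i) :=
    ContDiffOn.sum fun α _ =>
      (hS.pdTensor_contDiffOn i (hS.bendStress_contDiffOn hw E ν ζ) (by norm_num) α).mulVec
        ((hS.con_contDiffOn i α).of_le (by norm_num))
  exact h.continuousOn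

end Field

/-! ### Regularity along a boundary edge -/

omit i
variable (e : Fin S.nEdge)

lemma edgeVel_contDiffOn : ContDiffOn ℝ 2 (S.edgeVel e) (Icc 0 1) :=
  ((hS.x_smooth_cell (S.edgeElem e)).comp (hS.edgeCurve_contDiffOn e)
    (hS.mapsTo_edgeCurve e)).derivWithin (uniqueDiffOn_Icc zero_lt_one) (by norm_num)

lemma edgeSpeed_contDiffOn : ContDiffOn ℝ 2 (S.edgeSpeed e) (Icc 0 1) :=
  (hS.edgeVel_contDiffOn e).length fun _ hs => hS.edgeVel_ne_zero e hs

lemma edgeSpeed_inv_contDiffOn : ContDiffOn ℝ 2 (fun s => (S.edgeSpeed e s)⁻¹) (Icc 0 1) :=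
  (hS.edgeSpeed_contDiffOn e).inv fun _ hs => length_ne_zero (hS.edgeVel_ne_zero e hs)

lemma tangent_contDiffOn : ContDiffOn ℝ 2 (S.tangent e) (Icc 0 1) :=
  (hS.edgeSpeed_inv_contDiffOn e).smul (hS.edgeVel_contDiffOn e)

lemma normal_contDiffOn : ContDiffOn ℝ 2 (S.normal e) (Icc 0 1) :=
  (hS.tangent_contDiffOn e).crossProduct ((hS.director_contDiffOn _).comp
    ((hS.edgeCurve_contDiffOn e).of_le (by norm_num)) (hS.mapsTo_edgeCurve e))

section Field

variable {w : Plane → Space} (hw : ∀ i, ContDiffOn ℝ 3 w (S.cell i)) (E ν ζ : ℝ)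
include hw

lemma edgeBend_contDiffOn : TensorContDiffOn 1 (S.edgeBend E ν ζ e w) (Icc 0 1) :=
  (hS.bendStress_contDiffOn (hw _) E ν ζ).comp
    ((hS.edgeCurve_contDiffOn e).of_le (by norm_num)) (hS.mapsTo_edgeCurve e)

lemma Bnn_contDiffOn : ContDiffOn ℝ 1 (S.Bnn E ν ζ e w) (Icc 0 1) := by
  have hn : ContDiffOn ℝ 1 (S.normal e) (Icc 0 1) := (hS.normal_contDiffOn e).of_le (by norm_num)
  exact hn.dotProduct ((hS.edgeBend_contDiffOn e hw E ν ζ).mulVec hn)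

lemma Bnt_contDiffOn : ContDiffOn ℝ 1 (S.Bnt E ν ζ e w) (Icc 0 1) :=
  ((hS.normal_contDiffOn e).of_le (by norm_num)).dotProduct
    ((hS.edgeBend_contDiffOn e hw E ν ζ).mulVec ((hS.tangent_contDiffOn e).of_le (by norm_num)))

lemma TA_continuousOn : ContinuousOn (S.TA E ν ζ e w) (Icc 0 1) := by
  have h : ContDiffOn ℝ 2 (S.TA E ν ζ e w) (Icc 0 1) :=
    ((hS.memStress_contDiffOn (hw _) E ν ζ).comp
      ((hS.edgeCurve_contDiffOn e).of_le (by norm_num)) (hS.mapsTo_edgeCurve e)).mulVec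
      (hS.normal_contDiffOn e)
  exact h.continuousOn

lemma TB_continuousOn : ContinuousOn (S.TB E ν ζ e w) (Icc 0 1) := by
  have h : ContDiffOn ℝ 1 (S.TB E ν ζ e w) (Icc 0 1) :=
    (((hS.curvature_contDiffOn _).comp
      ((hS.edgeCurve_contDiffOn e).of_le (by norm_num)) (hS.mapsTo_edgeCurve e)).mulVec
      (((hS.edgeBend_contDiffOn e hw E ν ζ).mulVec
        ((hS.normal_contDiffOn e).of_le (by norm_num))).add
        ((hS.Bnt_contDiffOn e hw E ν ζ).smul
          ((hS.tangent_contDiffOn e).of_le (by norm_num))))).neg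
  exact h.continuousOn

lemma T3_continuousOn : ContinuousOn (S.T3 E ν ζ e w) (Icc 0 1) := by
  have h1 : ContinuousOn (fun s => S.divergence (S.edgeElem e)
      (S.bendStress E ν ζ (S.edgeElem e) w) (S.edgeCurve e s)) (Icc 0 1) :=
    (hS.divergence_continuousOn (hw _) E ν ζ).comp (hS.edgeCurve_contDiffOn e).continuousOn
      (hS.mapsTo_edgeCurve e)
  have h2 : ContDiffOn ℝ 0 (derivWithin (S.Bnt E ν ζ e w) (Icc 0 1)) (Icc 0 1) :=
    (hS.Bnt_contDiffOn e hw E ν ζ).derivWithin (uniqueDiffOn_Icc zero_lt_one) (by norm_num)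
  have h3 := (contDiffOn_zero.2 h1).dotProduct ((hS.normal_contDiffOn e).of_le (by norm_num))
  exact h3.continuousOn.add
    ((hS.edgeSpeed_inv_contDiffOn e).continuousOn.mul h2.continuousOn)

end Field

/-! ### Linearity in the displacement field -/

section Linear

variable {V : Submodule ℝ (Plane → Space)} (hV : ∀ w ∈ V, ∀ i, ContDiffOn ℝ 3 w (S.cell i))
  (i : Fin S.nElem) (E ν ζ : ℝ)

lemma pdTensor_isLinearMap {T : V → Plane → Tensor} (hT : IsLinearMap ℝ T)
    (hd : ∀ w, TensorContDiffOn 1 (T w) (S.cell i)) (α : Fin 2) :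
    IsLinearMap ℝ fun w => S.pdTensor i α (T w) := by
  have h : ∀ j k, IsLinearMap ℝ fun w => S.pd i α (fun p => T w p j k) := fun j k =>
    hS.pd_isLinearMap i
      ⟨fun v w => by funext p; rw [hT.map_add]; rfl, fun c w => by funext p; rw [hT.map_smul]; rfl⟩
      (fun w => (hd w j k).differentiableOn (by norm_num)) α
  constructor
  · intro v w
    funext p
    ext j k
    exact congrFun ((h j k).map_add v w) p
  · intro c w
    funext p
    ext j k
    exact congrFun ((h j k).map_smul c w) p

lemma pdTensor_const_smul (α : Fin 2) (c : ℝ) (T : Plane → Tensor) :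
    S.pdTensor i α (c • T) = c • S.pdTensor i α T := by
  funext p
  ext j k
  exact congrFun (hS.pd_const_smul i α c fun p => T p j k) p

include hV

lemma grad_isLinearMap : IsLinearMap ℝ fun w : V => S.grad i w := by
  have h : ∀ κ, IsLinearMap ℝ fun w : V => S.pd i κ (w : Plane → Space) := fun κ =>
    hS.pd_isLinearMap i ⟨fun _ _ => rfl, fun _ _ => rfl⟩
      (fun w : V => (hV w w.2 i).differentiableOn (by norm_num)) κ
  constructor
  · intro v w
    funext p
    simp only [grad, (h _).map_add, Pi.add_apply, add_vecMulVec, Finset.sum_add_distrib]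
  · intro c w
    funext p
    simp only [grad, (h _).map_smul, Pi.smul_apply, smul_vecMulVec, Finset.smul_sum]

lemma normalHessian_isLinearMap : IsLinearMap ℝ fun w : V => S.normalHessian i w := by
  have h := fun μ => hS.pdTensor_isLinearMap i (hS.grad_isLinearMap hV i)
    (fun w : V => (hS.grad_contDiffOn (hV w w.2 i)).of_le (by norm_num)) μ
  constructor
  · intro v w
    funext p
    simp only [normalHessian, (h _).map_add, Pi.add_apply, vecMul_add, add_vecMulVec,
      Finset.sum_add_distrib]
  · intro c w
    funext p
    simp only [normalHessian, (h _).map_smul, Pi.smul_apply, vecMul_smul, smul_vecMulVec,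
      Finset.smul_sum]

omit hS hV in
lemma proj_sym_proj_isLinearMap (p : Plane) :
    IsLinearMap ℝ fun M : Tensor => S.proj i p * Tensor.sym M * S.proj i p where
  map_add M N := by
    simp only [Tensor.sym, transpose_add, Matrix.mul_add, Matrix.add_mul, smul_add,
      Matrix.mul_smul, Matrix.smul_mul]
    abel
  map_smul c M := by
    simp only [Tensor.sym, transpose_smul, Matrix.mul_add, Matrix.add_mul, smul_add,
      Matrix.mul_smul, Matrix.smul_mul, smul_comm c]

lemma memStrain_isLinearMap : IsLinearMap ℝ fun w : V => S.memStrain i w := by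
  have h := hS.grad_isLinearMap hV i
  constructor
  · intro v w
    funext p
    have := (proj_sym_proj_isLinearMap i p).map_add (S.grad i v p) (S.grad i w p)
    simpa only [memStrain, h.map_add, Pi.add_apply] using this
  · intro c w
    funext p
    have := (proj_sym_proj_isLinearMap i p).map_smul c (S.grad i w p)
    simpa only [memStrain, h.map_smul, Pi.smul_apply] using this

lemma bendStrain_isLinearMap : IsLinearMap ℝ fun w : V => S.bendStrain i w := by
  have h := hS.normalHessian_isLinearMap hV i
  constructor
  · intro v w
    funext p
    have := (proj_sym_proj_isLinearMap i p).map_add (S.normalHessian i v p) (S.normalHessian i w p)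
    simpa only [bendStrain, h.map_add, Pi.add_apply, neg_add] using congrArg Neg.neg this
  · intro c w
    funext p
    have := (proj_sym_proj_isLinearMap i p).map_smul c (S.normalHessian i w p)
    simpa only [bendStrain, h.map_smul, Pi.smul_apply, smul_neg] using congrArg Neg.neg this

lemma memStress_isLinearMap : IsLinearMap ℝ fun w : V => S.memStress E ν ζ i w := by
  have h := hS.memStrain_isLinearMap hV i
  constructor
  · intro v w
    funext p
    simp only [memStress, h.map_add, Pi.add_apply, (elasticity_isLinearMap E ν).map_add, smul_add]
  · intro c w
    funext p
    simp only [memStress, h.map_smul, Pi.smul_apply, (elasticity_isLinearMap E ν).map_smul,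
      smul_comm c]

lemma bendStress_isLinearMap : IsLinearMap ℝ fun w : V => S.bendStress E ν ζ i w := by
  have h := hS.bendStrain_isLinearMap hV i
  constructor
  · intro v w
    funext p
    simp only [bendStress, h.map_add, Pi.add_apply, (elasticity_isLinearMap E ν).map_add, smul_add]
  · intro c w
    funext p
    simp only [bendStress, h.map_smul, Pi.smul_apply, (elasticity_isLinearMap E ν).map_smul,
      smul_comm c]

lemma divergence_isLinearMap :
    IsLinearMap ℝ fun w : V => S.divergence i (S.bendStress E ν ζ i w) := by
  have h := fun α => hS.pdTensor_isLinearMap i (hS.bendStress_isLinearMap hV i E ν ζ)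
    (fun w : V => hS.bendStress_contDiffOn (hV w w.2 i) E ν ζ) α
  constructor
  · intro v w
    funext p
    simp only [divergence, (h _).map_add, Pi.add_apply, add_mulVec, Finset.sum_add_distrib]
  · intro c w
    funext p
    simp only [divergence, (h _).map_smul, Pi.smul_apply, smul_mulVec, Finset.smul_sum]

lemma edgeBend_isLinearMap (s : ℝ) : IsLinearMap ℝ fun w : V => S.edgeBend E ν ζ e w s :=
  have h := hS.bendStress_isLinearMap hV (S.edgeElem e) E ν ζ
  ⟨fun v w => congrFun (h.map_add v w) _, fun c w => congrFun (h.map_smul c w) _⟩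

lemma Bnn_isLinearMap (s : ℝ) : IsLinearMap ℝ fun w : V => S.Bnn E ν ζ e w s := by
  have h := hS.edgeBend_isLinearMap e hV E ν ζ s
  constructor
  · intro v w
    simp only [Bnn, h.map_add, add_mulVec, dotProduct_add]
  · intro c w
    simp only [Bnn, h.map_smul, smul_mulVec, dotProduct_smul]

lemma Bnt_isLinearMap : IsLinearMap ℝ fun w : V => S.Bnt E ν ζ e w := by
  have h := hS.edgeBend_isLinearMap e hV E ν ζ
  constructor
  · intro v w
    funext s
    simp only [Bnt, (h s).map_add, add_mulVec, dotProduct_add, Pi.add_apply]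
  · intro c w
    funext s
    simp only [Bnt, (h s).map_smul, smul_mulVec, dotProduct_smul, Pi.smul_apply]

lemma jumpBnt_isLinearMap (c : Fin S.nEdge × Fin S.nEdge) :
    IsLinearMap ℝ fun w : V => S.jumpBnt E ν ζ c w := by
  have h := fun e => hS.Bnt_isLinearMap e hV E ν ζ
  constructor
  · intro v w
    simp only [jumpBnt, (h _).map_add, Pi.add_apply]
    ring
  · intro c w
    simp only [jumpBnt, (h _).map_smul, Pi.smul_apply, smul_sub]

lemma TA_isLinearMap (s : ℝ) : IsLinearMap ℝ fun w : V => S.TA E ν ζ e w s := by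
  have h := hS.memStress_isLinearMap hV (S.edgeElem e) E ν ζ
  constructor
  · intro v w
    simp only [TA, h.map_add, Pi.add_apply, add_mulVec]
  · intro c w
    simp only [TA, h.map_smul, Pi.smul_apply, smul_mulVec]

lemma TB_isLinearMap (s : ℝ) : IsLinearMap ℝ fun w : V => S.TB E ν ζ e w s := by
  have h := hS.edgeBend_isLinearMap e hV E ν ζ s
  have h2 := hS.Bnt_isLinearMap e hV E ν ζ
  constructor
  · intro v w
    simp only [TB, h.map_add, h2.map_add, Pi.add_apply, add_mulVec, add_smul, mulVec_add]
    abel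
  · intro c w
    simp only [TB, h.map_smul, h2.map_smul, Pi.smul_apply, smul_mulVec, smul_assoc, mulVec_add,
      mulVec_smul, smul_add, smul_neg]

lemma T3_isLinearMap {s : ℝ} (hs : s ∈ Icc (0 : ℝ) 1) :
    IsLinearMap ℝ fun w : V => S.T3 E ν ζ e w s := by
  have h := hS.divergence_isLinearMap hV (S.edgeElem e) E ν ζ
  have h2 := hS.Bnt_isLinearMap e hV E ν ζ
  have hd : ∀ w : V, DifferentiableWithinAt ℝ (S.Bnt E ν ζ e w) (Icc 0 1) s := fun w =>
    (hS.Bnt_contDiffOn e (hV w w.2) E ν ζ).differentiableOn (by norm_num) s hs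
  constructor
  · intro v w
    simp only [T3, h.map_add, h2.map_add, Pi.add_apply, add_dotProduct,
      derivWithin_add (hd v) (hd w)]
    ring
  · intro c w
    simp only [T3, h.map_smul, h2.map_smul, Pi.smul_apply, smul_dotProduct, smul_eq_mul,
      derivWithin_const_smul c (hd w)]
    ring

end Linear

end IsAdmissible

/-- Fields of a spline space are three times continuously differentiable on each element: there
they are rational functions of the coordinates of the inverse chart. -/
lemma IsSplineSpace.contDiffOn_cell {V : Submodule ℝ (Plane → Space)} (hV : S.IsSplineSpace V)
    (hS : S.IsAdmissible) {w : Plane → Space} (hw : w ∈ V) (i : Fin S.nElem) :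
    ContDiffOn ℝ 3 w (S.cell i) := by
  refine contDiffOn_pi.2 fun k => ?_
  obtain ⟨P, Q, hPQ⟩ := hV.rational w hw i k
  have hsymm : ContDiffOn ℝ 3 (S.chart i).symm (S.cell i) :=
    (hS.chart_symm_smooth i).mono (hS.cell_subset_target i)
  refine ((P.contDiff_eval.comp_contDiffOn hsymm).div (Q.contDiff_eval.comp_contDiffOn hsymm)
    fun p hp => (hPQ _ (hS.symm_mem_ref i hp)).1).congr fun p hp => ?_
  have h := (hPQ _ (hS.symm_mem_ref i hp)).2
  rwa [(S.chart i).right_inv (hS.cell_subset_target i hp)] at h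

end ShellData

namespace ShellData

variable {S : ShellData}

/-! ### The strain energy form -/

/-- The membrane part of the strain energy form. -/
noncomputable def memEnergy (S : ShellData) (E ν ζ : ℝ) (w v : Plane → Space) : ℝ :=
  ∑ i, ∫ p in S.cell i,
    Tensor.ddot (S.memStress E ν ζ i w p) (S.memStrain i v p) * S.areaDensity i p

/-- The bending part of the strain energy form. -/
noncomputable def bendEnergy (S : ShellData) (E ν ζ : ℝ) (w v : Plane → Space) : ℝ :=
  ∑ i, ∫ p in S.cell i,
    Tensor.ddot (S.bendStress E ν ζ i w p) (S.bendStrain i v p) * S.areaDensity i p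

lemma memStress_scale (E ν ζ : ℝ) (i : Fin S.nElem) (w : Plane → Space) :
    S.memStress E ν ζ i w = (E * ζ) • S.memStress 1 ν 1 i w := by
  funext p
  simp only [memStress, Pi.smul_apply, elasticity_scale E, smul_smul]
  congr 1
  ring

lemma bendStress_scale (E ν ζ : ℝ) (i : Fin S.nElem) (w : Plane → Space) :
    S.bendStress E ν ζ i w = (E * ζ ^ 3) • S.bendStress 1 ν 1 i w := by
  funext p
  simp only [bendStress, Pi.smul_apply, elasticity_scale E, smul_smul]
  congr 1
  ring

lemma memEnergy_scale (E ν ζ : ℝ) (w v : Plane → Space) :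
    S.memEnergy E ν ζ w v = E * ζ * S.memEnergy 1 ν 1 w v := by
  simp only [memEnergy, memStress_scale E ν ζ, Pi.smul_apply, ddot_smul_left, mul_assoc (E * ζ),
    integral_const_mul, Finset.mul_sum]

lemma bendEnergy_scale (E ν ζ : ℝ) (w v : Plane → Space) :
    S.bendEnergy E ν ζ w v = E * ζ ^ 3 * S.bendEnergy 1 ν 1 w v := by
  simp only [bendEnergy, bendStress_scale E ν ζ, Pi.smul_apply, ddot_smul_left,
    mul_assoc (E * ζ ^ 3), integral_const_mul, Finset.mul_sum]

lemma ddot_stress_of_strain_eq_zero (c E ν : ℝ) {i : Fin S.nElem} {p : Plane} {N : Tensor}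
    (hN : N = 0) : Tensor.ddot (c • S.elasticity E ν i p N) N = 0 := by
  simp [hN, Tensor.ddot]

/-- The exponent `n` for which the trace form scales by `E ζ ^ n`: `3` for the forms built from the
bending stress, `1` for the one built from the membrane stress. -/
def thicknessExponent : Fin 5 → ℕ := ![3, 3, 3, 3, 1]

namespace IsAdmissible

variable (hS : S.IsAdmissible) {V : Submodule ℝ (Plane → Space)}
  (hV : ∀ w ∈ V, ∀ i, ContDiffOn ℝ 3 w (S.cell i)) {E ν ζ : ℝ}
include hS

lemma ddot_elasticity_continuousOn (E ν c : ℝ) (i : Fin S.nElem) {T U : Plane → Tensor}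
    (hT : TensorContDiffOn 0 T (S.cell i)) (hU : TensorContDiffOn 0 U (S.cell i)) :
    ContinuousOn (fun p => Tensor.ddot (c • S.elasticity E ν i p (T p)) (U p) *
      S.areaDensity i p) (S.cell i) :=
  ((TensorContDiffOn.smul contDiffOn_const
    (hS.elasticity_contDiffOn i (by norm_num) E ν hT)).ddot hU).continuousOn.mul
    (hS.areaDensity_continuousOn i)

/-- The elastic energy form of a strain measure `T` that depends linearly on the displacement. -/
lemma elasticEnergy_isPosForm (hE : 0 < E) (hν₀ : 0 ≤ ν) (hν₁ : ν ≤ 1 / 2) {c : ℝ} (hc : 0 ≤ c)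
    {T : (i : Fin S.nElem) → V → Plane → Tensor} (hT : ∀ i, IsLinearMap ℝ (T i))
    (hreg : ∀ i w, TensorContDiffOn 0 (T i w) (S.cell i)) :
    IsPosForm fun w v : V => ∑ i, ∫ p in S.cell i,
      Tensor.ddot (c • S.elasticity E ν i p (T i w p)) (T i v p) * S.areaDensity i p := by
  refine IsPosForm.sum _ fun i _ => IsPosForm.setIntegral (hS.isCompact_cell i).measurableSet
    (fun p hp => ?_) fun w v =>
      (hS.ddot_elasticity_continuousOn E ν c i (hreg i w) (hreg i v)).integrableOn_compact
        (hS.isCompact_cell i)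
  have hlin : IsLinearMap ℝ fun w : V => T i w p :=
    ⟨fun v w => congrFun ((hT i).map_add v w) p, fun a w => congrFun ((hT i).map_smul a w) p⟩
  have h := ((hS.ddot_elasticity_isPosForm hp hE hν₀ hν₁).comp hlin).const_mul
    (mul_nonneg hc (hS.areaDensity_pos hp).le)
  simpa only [ddot_smul_left, mul_right_comm c] using h

/-- A displacement of vanishing elastic energy has pointwise vanishing energy density. -/
lemma ddot_elasticity_eq_zero (hE : 0 < E) (hν₀ : 0 ≤ ν) (hν₁ : ν ≤ 1 / 2) {c : ℝ} (hc : 0 < c)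
    {T : Fin S.nElem → Plane → Tensor} (hreg : ∀ i, TensorContDiffOn 0 (T i) (S.cell i))
    (h : ∑ i, ∫ p in S.cell i,
      Tensor.ddot (c • S.elasticity E ν i p (T i p)) (T i p) * S.areaDensity i p = 0)
    (i : Fin S.nElem) {p : Plane} (hp : p ∈ S.cell i) :
    Tensor.ddot (S.elasticity E ν i p (T i p)) (T i p) = 0 := by
  have hnn : ∀ i, ∀ p ∈ S.cell i,
      0 ≤ Tensor.ddot (c • S.elasticity E ν i p (T i p)) (T i p) * S.areaDensity i p :=
    fun i p hp => mul_nonneg (by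
      rw [ddot_smul_left]
      exact mul_nonneg hc.le ((hS.ddot_elasticity_isPosForm hp hE hν₀ hν₁).nonneg _))
      (hS.areaDensity_pos hp).le
  have h1 := (Finset.sum_eq_zero_iff_of_nonneg fun i _ =>
    setIntegral_nonneg (hS.isCompact_cell i).measurableSet (hnn i)).1 h i (Finset.mem_univ i)
  have h2 := hS.eq_zero_of_setIntegral_eq_zero i
    (hS.ddot_elasticity_continuousOn E ν c i (hreg i) (hreg i)) (hnn i) h1 p hp
  rw [ddot_smul_left] at h2
  simpa [hc.ne', (hS.areaDensity_pos hp).ne'] using h2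

include hV

lemma memEnergy_isPosForm (hE : 0 < E) (hν₀ : 0 ≤ ν) (hν₁ : ν ≤ 1 / 2) (hζ : 0 < ζ) :
    IsPosForm fun w v : V => S.memEnergy E ν ζ w v :=
  hS.elasticEnergy_isPosForm hE hν₀ hν₁ hζ.le (T := fun i w => S.memStrain i w)
    (hS.memStrain_isLinearMap hV)
    fun i w => (hS.memStrain_contDiffOn (hV w w.2 i)).of_le (by norm_num)

lemma bendEnergy_isPosForm (hE : 0 < E) (hν₀ : 0 ≤ ν) (hν₁ : ν ≤ 1 / 2) (hζ : 0 < ζ) :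
    IsPosForm fun w v : V => S.bendEnergy E ν ζ w v :=
  hS.elasticEnergy_isPosForm hE hν₀ hν₁ (c := ζ ^ 3 / 12) (by positivity)
    (T := fun i w => S.bendStrain i w) (hS.bendStrain_isLinearMap hV)
    fun i w => (hS.bendStrain_contDiffOn (hV w w.2 i)).of_le (by norm_num)

lemma memEnergy_eq_zero_iff (hE : 0 < E) (hν₀ : 0 ≤ ν) (hν₁ : ν ≤ 1 / 2) (hζ : 0 < ζ) (w : V) :
    S.memEnergy E ν ζ w w = 0 ↔ ∀ i, ∀ p ∈ S.cell i, S.memStrain i w p = 0 := by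
  constructor
  · intro h i p hp
    exact hS.memStrain_eq_zero hp hE hν₀ hν₁ (hS.ddot_elasticity_eq_zero hE hν₀ hν₁ hζ
      (fun i => (hS.memStrain_contDiffOn (hV w w.2 i)).of_le (by norm_num)) h i hp)
  · intro h
    refine Finset.sum_eq_zero fun i _ => setIntegral_eq_zero_of_forall_eq_zero fun p hp => ?_
    rw [memStress, ddot_stress_of_strain_eq_zero _ _ _ (h i p hp), zero_mul]

lemma bendEnergy_eq_zero_iff (hE : 0 < E) (hν₀ : 0 ≤ ν) (hν₁ : ν ≤ 1 / 2) (hζ : 0 < ζ) (w : V) :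
    S.bendEnergy E ν ζ w w = 0 ↔ ∀ i, ∀ p ∈ S.cell i, S.bendStrain i w p = 0 := by
  constructor
  · intro h i p hp
    exact hS.bendStrain_eq_zero hp hE hν₀ hν₁ (hS.ddot_elasticity_eq_zero hE hν₀ hν₁
      (c := ζ ^ 3 / 12) (by positivity)
      (fun i => (hS.bendStrain_contDiffOn (hV w w.2 i)).of_le (by norm_num)) h i hp)
  · intro h
    refine Finset.sum_eq_zero fun i _ => setIntegral_eq_zero_of_forall_eq_zero fun p hp => ?_
    rw [bendStress, ddot_stress_of_strain_eq_zero _ _ _ (h i p hp), zero_mul]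

lemma energy_isPosForm (hE : 0 < E) (hν₀ : 0 ≤ ν) (hν₁ : ν ≤ 1 / 2) (hζ : 0 < ζ) :
    IsPosForm fun w v : V => S.energy E ν ζ w v :=
  (hS.memEnergy_isPosForm hV hE hν₀ hν₁ hζ).add (hS.bendEnergy_isPosForm hV hE hν₀ hν₁ hζ)

lemma energy_eq_zero_iff (hE : 0 < E) (hν₀ : 0 ≤ ν) (hν₁ : ν ≤ 1 / 2) (hζ : 0 < ζ) (w : V) :
    S.energy E ν ζ w w = 0 ↔ (w : Plane → Space) ∈ S.rigidModes V := by
  have h : S.energy E ν ζ w w = S.memEnergy E ν ζ w w + S.bendEnergy E ν ζ w w := rfl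
  rw [h, add_eq_zero_iff_of_nonneg ((hS.memEnergy_isPosForm hV hE hν₀ hν₁ hζ).nonneg w)
    ((hS.bendEnergy_isPosForm hV hE hν₀ hν₁ hζ).nonneg w),
    hS.memEnergy_eq_zero_iff hV hE hν₀ hν₁ hζ, hS.bendEnergy_eq_zero_iff hV hE hν₀ hν₁ hζ]
  exact ⟨fun h => ⟨w.2, fun i p hp => ⟨h.1 i p hp, h.2 i p hp⟩⟩,
    fun h => ⟨fun i p hp => (h.2 i p hp).1, fun i p hp => (h.2 i p hp).2⟩⟩

lemma innerL2_continuousOn (i : Fin S.nElem) (w v : V) :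
    ContinuousOn (fun p => ((w : Plane → Space) p ⬝ᵥ (v : Plane → Space) p) * S.areaDensity i p)
      (S.cell i) :=
  ((hV w w.2 i).dotProduct (hV v v.2 i)).continuousOn.mul (hS.areaDensity_continuousOn i)

lemma innerL2_isPosForm : IsPosForm fun w v : V => S.innerL2 w v := by
  refine IsPosForm.sum _ fun i _ => IsPosForm.setIntegral (hS.isCompact_cell i).measurableSet
    (fun p hp => ?_) fun w v =>
      (hS.innerL2_continuousOn hV i w v).integrableOn_compact (hS.isCompact_cell i)
  have hlin : IsLinearMap ℝ fun w : V => (w : Plane → Space) p := ⟨fun _ _ => rfl, fun _ _ => rfl⟩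
  have h := (IsPosForm.dotProduct.comp hlin).const_mul (hS.areaDensity_pos hp).le
  simpa only [mul_comm] using h

lemma innerL2_eq_zero (w : V) (h : S.innerL2 w w = 0) (i : Fin S.nElem) {p : Plane}
    (hp : p ∈ S.cell i) : (w : Plane → Space) p = 0 := by
  have hnn : ∀ i, ∀ p ∈ S.cell i,
      0 ≤ ((w : Plane → Space) p ⬝ᵥ (w : Plane → Space) p) * S.areaDensity i p :=
    fun i p hp => mul_nonneg (IsPosForm.dotProduct.nonneg _) (hS.areaDensity_pos hp).le
  have h1 := (Finset.sum_eq_zero_iff_of_nonneg fun i _ =>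
    setIntegral_nonneg (hS.isCompact_cell i).measurableSet (hnn i)).1 h i (Finset.mem_univ i)
  have h2 := hS.eq_zero_of_setIntegral_eq_zero i (hS.innerL2_continuousOn hV i w w) (hnn i) h1 p hp
  exact dotProduct_self_eq_zero.1 ((mul_eq_zero.1 h2).resolve_right (hS.areaDensity_pos hp).ne')

/-! ### The boundary and corner forms -/

omit hV in
/-- A weighted boundary form is positive semidefinite; the magnitude `|ℂ|` in the weight is
constant, so that the weight is continuous. -/
lemma edgeIntegral_isPosForm {a c : ℝ} (ha : 0 ≤ a) (hc : 0 ≤ c) (e : Fin S.nEdge)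
    {b : ℝ → V → V → ℝ} (hb : ∀ s ∈ Icc (0 : ℝ) 1, IsPosForm (b s))
    (hcont : ∀ u v, ContinuousOn (fun s => b s u v) (Icc 0 1)) :
    IsPosForm fun w v : V => S.edgeIntegral e fun s =>
      a / (c * S.elasticityNorm E ν (S.edgeElem e) (S.edgeCurve e s)) * b s w v := by
  refine IsPosForm.intervalIntegral (fun s hs => ?_) fun w v => ?_
  · have h := (hb s hs).const_mul (c := a / (c * S.elasticityNorm E ν (S.edgeElem e)
      (S.edgeCurve e s)) * S.edgeSpeed e s) (mul_nonneg (div_nonneg ha (mul_nonneg hc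
        (Real.sqrt_nonneg _))) (Real.sqrt_nonneg _))
    simpa only [mul_right_comm] using h
  · refine (ContinuousOn.mul ?_ (hcont w v)).mul (hS.edgeSpeed_contDiffOn e).continuousOn
    refine (continuousOn_const (c := a / (c * √((E / (2 * (1 + ν))) ^ 2 *
      (12 + 8 * (2 * ν / (1 - ν)) + 4 * (2 * ν / (1 - ν)) ^ 2))))).congr fun s hs => ?_
    rw [hS.elasticityNorm_eq (hS.edgeCurve_mem e hs)]

lemma traceForm_isPosForm (hζ : 0 < ζ) {C : ℝ} (hC : 0 < C) (k : Fin 5) :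
    IsPosForm fun w v : V => S.traceForm E ν ζ C w v k := by
  have hsize : ∀ i, 0 ≤ S.elemSize i := fun i => Metric.diam_nonneg
  have hc : ∀ w : V, ∀ i, ContDiffOn ℝ 3 (w : Plane → Space) (S.cell i) := fun w => hV w w.2
  match k with
  | 0 =>
    exact IsPosForm.sum _ fun e _ => hS.edgeIntegral_isPosForm (pow_nonneg (hsize _) 3)
      (by positivity) e
      (fun s hs => IsPosForm.mul.comp (hS.T3_isLinearMap e hV E ν ζ hs)) fun u v =>
        (hS.T3_continuousOn e (hc u) E ν ζ).mul (hS.T3_continuousOn e (hc v) E ν ζ)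
  | 1 =>
    exact IsPosForm.sum _ fun c _ =>
      (IsPosForm.mul.comp (hS.jumpBnt_isLinearMap hV E ν ζ c)).const_mul
        (div_nonneg (pow_nonneg (hsize _) 2) (mul_nonneg (by positivity) (Real.sqrt_nonneg _)))
  | 2 =>
    exact IsPosForm.sum _ fun e _ => hS.edgeIntegral_isPosForm (hsize _) (by positivity) e
      (fun s _ => IsPosForm.mul.comp (hS.Bnn_isLinearMap e hV E ν ζ s)) fun u v =>
        (hS.Bnn_contDiffOn e (hc u) E ν ζ).continuousOn.mul
          (hS.Bnn_contDiffOn e (hc v) E ν ζ).continuousOn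
  | 3 =>
    exact IsPosForm.sum _ fun e _ => hS.edgeIntegral_isPosForm (hsize _) (by positivity) e
      (fun s _ => IsPosForm.dotProduct.comp (hS.TB_isLinearMap e hV E ν ζ s)) fun u v =>
        ((contDiffOn_zero.2 (hS.TB_continuousOn e (hc u) E ν ζ)).dotProduct
          (contDiffOn_zero.2 (hS.TB_continuousOn e (hc v) E ν ζ))).continuousOn
  | 4 =>
    exact IsPosForm.sum _ fun e _ => hS.edgeIntegral_isPosForm (hsize _) (by positivity) e
      (fun s _ => IsPosForm.dotProduct.comp (hS.TA_isLinearMap e hV E ν ζ s)) fun u v =>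
        ((contDiffOn_zero.2 (hS.TA_continuousOn e (hc u) E ν ζ)).dotProduct
          (contDiffOn_zero.2 (hS.TA_continuousOn e (hc v) E ν ζ))).continuousOn

/-! ### The boundary quantities of a strain-free field -/

omit hV

omit hS in
lemma edgeIntegral_eq_zero {e : Fin S.nEdge} {f : ℝ → ℝ} (hf : ∀ s ∈ Icc (0 : ℝ) 1, f s = 0) :
    S.edgeIntegral e f = 0 := by
  refine (intervalIntegral.integral_congr (g := fun _ => 0) fun s hs => ?_).trans (by simp)
  rw [uIcc_of_le zero_le_one] at hs
  simp [hf s hs]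

omit hS in
lemma bendStress_eq_zero {i : Fin S.nElem} {w : Plane → Space} {p : Plane}
    (h : S.bendStrain i w p = 0) : S.bendStress E ν ζ i w p = 0 := by
  rw [bendStress, h, (elasticity_isLinearMap E ν).map_zero, smul_zero]

omit hS in
lemma divergence_eq_zero {i : Fin S.nElem} {T : Plane → Tensor} {p : Plane} (hp : p ∈ S.cell i)
    (h : ∀ q ∈ S.cell i, T q = 0) : S.divergence i T p = 0 := by
  have hpd : ∀ α, S.pdTensor i α T p = 0 := fun α => by
    ext j k
    have : fderivWithin ℝ (fun q => T q j k) (S.cell i) p = 0 := by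
      rw [fderivWithin_congr' (f := fun _ => (0 : ℝ)) (fun q hq => by rw [h q hq]; rfl) hp]
      simp
    simp [pdTensor, pd, this]
  simp [divergence, hpd]

section Vanishing

variable {w : Plane → Space}

omit hS in
lemma TA_eq_zero (e : Fin S.nEdge) {s : ℝ}
    (h : S.memStrain (S.edgeElem e) w (S.edgeCurve e s) = 0) : S.TA E ν ζ e w s = 0 := by
  rw [TA, memStress, h, (elasticity_isLinearMap E ν).map_zero, smul_zero, zero_mulVec]

variable (hw : ∀ i, ∀ p ∈ S.cell i, S.bendStrain i w p = 0) (e : Fin S.nEdge)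
include hw

lemma edgeBend_eq_zero {s : ℝ} (hs : s ∈ Icc (0 : ℝ) 1) : S.edgeBend E ν ζ e w s = 0 :=
  bendStress_eq_zero (hw _ _ (hS.edgeCurve_mem e hs))

lemma Bnn_eq_zero {s : ℝ} (hs : s ∈ Icc (0 : ℝ) 1) : S.Bnn E ν ζ e w s = 0 := by
  rw [Bnn, hS.edgeBend_eq_zero hw e hs, zero_mulVec, dotProduct_zero]

lemma Bnt_eq_zero {s : ℝ} (hs : s ∈ Icc (0 : ℝ) 1) : S.Bnt E ν ζ e w s = 0 := by
  rw [Bnt, hS.edgeBend_eq_zero hw e hs, zero_mulVec, dotProduct_zero]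

lemma TB_eq_zero {s : ℝ} (hs : s ∈ Icc (0 : ℝ) 1) : S.TB E ν ζ e w s = 0 := by
  rw [TB, hS.edgeBend_eq_zero hw e hs, hS.Bnt_eq_zero hw e hs, zero_mulVec, zero_smul, add_zero,
    mulVec_zero, neg_zero]

lemma T3_eq_zero {s : ℝ} (hs : s ∈ Icc (0 : ℝ) 1) : S.T3 E ν ζ e w s = 0 := by
  have h1 : derivWithin (S.Bnt E ν ζ e w) (Icc 0 1) s = 0 := by
    rw [derivWithin_congr (f := fun _ => (0 : ℝ)) (fun r hr => hS.Bnt_eq_zero hw e hr)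
      (hS.Bnt_eq_zero hw e hs)]
    simp
  rw [T3, h1, divergence_eq_zero (hS.edgeCurve_mem e hs) fun q hq => bendStress_eq_zero (hw _ q hq),
    zero_dotProduct, mul_zero, add_zero]

lemma traceForm_eq_zero_of_bendStrain {C : ℝ} {k : Fin 5} (hk : k ≠ 4) :
    S.traceForm E ν ζ C w w k = 0 := by
  match k with
  | 0 =>
    exact Finset.sum_eq_zero fun e _ => edgeIntegral_eq_zero fun s hs => by
      rw [hS.T3_eq_zero hw e hs, mul_zero, mul_zero]
  | 1 =>
    refine Finset.sum_eq_zero fun c _ => ?_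
    rw [jumpBnt, hS.Bnt_eq_zero hw c.2 (left_mem_Icc.2 zero_le_one),
      hS.Bnt_eq_zero hw c.1 (right_mem_Icc.2 zero_le_one), sub_zero, mul_zero, mul_zero]
  | 2 =>
    exact Finset.sum_eq_zero fun e _ => edgeIntegral_eq_zero fun s hs => by
      rw [hS.Bnn_eq_zero hw e hs, mul_zero, mul_zero]
  | 3 =>
    exact Finset.sum_eq_zero fun e _ => edgeIntegral_eq_zero fun s hs => by
      rw [hS.TB_eq_zero hw e hs, dotProduct_zero, mul_zero]
  | 4 => exact absurd rfl hk

end Vanishing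

lemma traceForm_eq_zero_of_memStrain {w : Plane → Space}
    (hw : ∀ i, ∀ p ∈ S.cell i, S.memStrain i w p = 0) {C : ℝ} :
    S.traceForm E ν ζ C w w 4 = 0 :=
  Finset.sum_eq_zero fun e _ => edgeIntegral_eq_zero fun s hs => by
    rw [TA_eq_zero e (hw _ _ (hS.edgeCurve_mem e hs)), dotProduct_zero, mul_zero]

/-! ### Scaling in the thickness and in Young's modulus -/

section Scaling

variable (E ν ζ) (e : Fin S.nEdge) (w : Plane → Space)

omit hS in
lemma elasticityNorm_scale (hE : 0 ≤ E) (i : Fin S.nElem) (p : Plane) :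
    S.elasticityNorm E ν i p = E * S.elasticityNorm 1 ν i p := by
  simp only [elasticityNorm, elasticityCoeff_scale E]
  rw [← Real.sqrt_sq hE, ← Real.sqrt_mul (sq_nonneg _), Real.sqrt_sq hE]
  simp only [Finset.mul_sum]
  congr 1
  refine Finset.sum_congr rfl fun _ _ => Finset.sum_congr rfl fun _ _ =>
    Finset.sum_congr rfl fun _ _ => Finset.sum_congr rfl fun _ _ => by ring

omit hS in
lemma edgeBend_scale (s : ℝ) :
    S.edgeBend E ν ζ e w s = (E * ζ ^ 3) • S.edgeBend 1 ν 1 e w s := by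
  rw [edgeBend, bendStress_scale]
  rfl

omit hS in
lemma Bnn_scale (s : ℝ) : S.Bnn E ν ζ e w s = E * ζ ^ 3 * S.Bnn 1 ν 1 e w s := by
  rw [Bnn, edgeBend_scale, smul_mulVec, dotProduct_smul, smul_eq_mul, Bnn]

omit hS in
lemma Bnt_scale : S.Bnt E ν ζ e w = (E * ζ ^ 3) • S.Bnt 1 ν 1 e w := by
  funext s
  rw [Bnt, edgeBend_scale, smul_mulVec, dotProduct_smul, Pi.smul_apply, Bnt]

omit hS in
lemma TB_scale (s : ℝ) : S.TB E ν ζ e w s = (E * ζ ^ 3) • S.TB 1 ν 1 e w s := by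
  rw [TB, edgeBend_scale, Bnt_scale, TB, Pi.smul_apply, smul_assoc, smul_mulVec, ← smul_add,
    mulVec_smul, smul_neg]

omit hS in
lemma TA_scale (s : ℝ) : S.TA E ν ζ e w s = (E * ζ) • S.TA 1 ν 1 e w s := by
  rw [TA, memStress_scale, TA, Pi.smul_apply, smul_mulVec]

lemma T3_scale (s : ℝ) : S.T3 E ν ζ e w s = E * ζ ^ 3 * S.T3 1 ν 1 e w s := by
  have h : S.divergence (S.edgeElem e) (S.bendStress E ν ζ (S.edgeElem e) w) =
      (E * ζ ^ 3) • S.divergence (S.edgeElem e) (S.bendStress 1 ν 1 (S.edgeElem e) w) := by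
    funext p
    simp only [divergence, bendStress_scale E ν ζ, hS.pdTensor_const_smul, Pi.smul_apply,
      smul_mulVec, Finset.smul_sum]
  rw [T3, h, Bnt_scale, derivWithin_const_smul_field, Pi.smul_apply, smul_dotProduct, T3]
  simp only [smul_eq_mul]
  ring

omit hS in
lemma jumpBnt_scale (c : Fin S.nEdge × Fin S.nEdge) :
    S.jumpBnt E ν ζ c w = E * ζ ^ 3 * S.jumpBnt 1 ν 1 c w := by
  rw [jumpBnt, Bnt_scale, Bnt_scale E, jumpBnt, Pi.smul_apply, Pi.smul_apply, smul_eq_mul,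
    smul_eq_mul, mul_sub]

omit hS in
lemma edgeIntegral_const_mul (c : ℝ) (f : ℝ → ℝ) :
    S.edgeIntegral e (fun s => c * f s) = c * S.edgeIntegral e f := by
  simp only [edgeIntegral, mul_assoc, intervalIntegral.integral_const_mul]

omit hS in
/-- The scaling of one weighted product; `N` is the magnitude `|ℂ|`, which may be any number. -/
lemma weight_scale {E m C : ℝ} (hE : E ≠ 0) (hm : m ≠ 0) (a N x : ℝ) :
    a / (C * m * (E * N)) * (E * m * (E * m * x)) = E * m / C * (a / (1 * 1 * N) * x) := by
  simp only [div_eq_mul_inv, mul_inv, one_mul]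
  generalize N⁻¹ = M
  generalize C⁻¹ = D
  field_simp

omit hS in
lemma weight_scale_mul {E m C : ℝ} (hE : E ≠ 0) (hm : m ≠ 0) (a N x y : ℝ) :
    a / (C * m * (E * N)) * (E * m * x * (E * m * y)) =
      E * m / C * (a / (1 * 1 * N) * (x * y)) := by
  rw [← weight_scale hE hm]
  ring

/-- The five forms depend on the trace constant, on the thickness and on Young's modulus through
a factor only. -/
lemma traceForm_scale {E ζ : ℝ} (hE : 0 < E) (hζ : 0 < ζ) (C : ℝ) (w v : Plane → Space)
    (k : Fin 5) : S.traceForm E ν ζ C w v k =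
      E * ζ ^ thicknessExponent k / C * S.traceForm 1 ν 1 1 w v k := by
  have hζ3 : ζ ^ 3 ≠ 0 := by positivity
  match k with
  | 0 =>
    simp only [traceForm, thicknessExponent, Finset.mul_sum]
    refine Finset.sum_congr rfl fun e _ => ?_
    rw [← edgeIntegral_const_mul]
    congr 1
    funext s
    rw [hS.T3_scale E, hS.T3_scale E ν ζ e v, elasticityNorm_scale E ν hE.le, one_pow]
    exact weight_scale_mul hE.ne' hζ3 _ _ _ _
  | 1 =>
    simp only [traceForm, thicknessExponent, Finset.mul_sum]
    refine Finset.sum_congr rfl fun c _ => ?_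
    rw [jumpBnt_scale E, jumpBnt_scale E ν ζ v, elasticityNorm_scale E ν hE.le, one_pow]
    exact weight_scale_mul hE.ne' hζ3 _ _ _ _
  | 2 =>
    simp only [traceForm, thicknessExponent, Finset.mul_sum]
    refine Finset.sum_congr rfl fun e _ => ?_
    rw [← edgeIntegral_const_mul]
    congr 1
    funext s
    rw [Bnn_scale E, Bnn_scale E ν ζ e v, elasticityNorm_scale E ν hE.le, one_pow]
    exact weight_scale_mul hE.ne' hζ3 _ _ _ _
  | 3 =>
    simp only [traceForm, thicknessExponent, Finset.mul_sum]
    refine Finset.sum_congr rfl fun e _ => ?_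
    rw [← edgeIntegral_const_mul]
    congr 1
    funext s
    rw [TB_scale E, TB_scale E ν ζ e v, elasticityNorm_scale E ν hE.le, one_pow, smul_dotProduct,
      dotProduct_smul, smul_eq_mul, smul_eq_mul]
    exact weight_scale hE.ne' hζ3 _ _ _
  | 4 =>
    simp only [traceForm, thicknessExponent, Finset.mul_sum]
    refine Finset.sum_congr rfl fun e _ => ?_
    rw [← edgeIntegral_const_mul]
    congr 1
    funext s
    rw [TA_scale E, TA_scale E ν ζ e v, elasticityNorm_scale E ν hE.le, smul_dotProduct,
      dotProduct_smul, smul_eq_mul, smul_eq_mul]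
    rw [show ζ ^ (![3, 3, 3, 3, 1] : Fin 5 → ℕ) 4 = ζ from pow_one ζ]
    exact weight_scale hE.ne' hζ.ne' _ _ _

end Scaling

end IsAdmissible

/-! ### The trace inequalities and their optimal constants -/

/-- The `L²` form is definite on a spline space: a field that vanishes on the elements vanishes on
the closed parametric domain, which they cover, and it is zero elsewhere by convention. -/
lemma IsSplineSpace.eq_zero_of_innerL2 {V : Submodule ℝ (Plane → Space)}
    (hV : S.IsSplineSpace V) (hS : S.IsAdmissible) (w : V) (h : S.innerL2 w w = 0) : w = 0 := by
  refine Subtype.ext (funext fun p => ?_)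
  by_cases hp : p ∈ closure S.dom
  · obtain ⟨i, hi⟩ := mem_iUnion.1 (hS.closure_dom_subset hp)
    exact hS.innerL2_eq_zero (fun w hw => hV.contDiffOn_cell hS hw) w h i hi
  · exact hV.support_subset w w.2 p hp

/-- A trace constant that serves all thicknesses and Young's moduli, by comparison with a part `e`
of the strain energy that scales like the trace form. -/
lemma IsSplineSpace.exists_trace_constant {V : Submodule ℝ (Plane → Space)}
    (hV : S.IsSplineSpace V) (hS : S.IsAdmissible) {ν : ℝ} {k : Fin 5} {e : V → V → ℝ}
    (he : IsPosForm e) (hker : ∀ v, e v v = 0 → S.traceForm 1 ν 1 1 v v k = 0)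
    (hle : ∀ E ζ : ℝ, 0 < E → 0 < ζ → ∀ v : V,
      E * ζ ^ thicknessExponent k * e v v ≤ S.energy E ν ζ v v) :
    ∃ C, 0 < C ∧ ∀ E ζ : ℝ, 0 < E → 0 < ζ → ∀ v ∈ V,
      S.traceForm E ν ζ C v v k ≤ 1 / 5 * S.energy E ν ζ v v := by
  have hfin := hV.finiteDimensional
  have hV' : ∀ w ∈ V, ∀ i, ContDiffOn ℝ 3 w (S.cell i) := fun w hw => hV.contDiffOn_cell hS hw
  obtain ⟨c, hc, hbound⟩ := (hS.innerL2_isPosForm hV').exists_bound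
    (hV.eq_zero_of_innerL2 hS) he (hS.traceForm_isPosForm hV' one_pos one_pos k) hker
  refine ⟨5 * c, by positivity, fun E ζ hE hζ v hv => ?_⟩
  rw [hS.traceForm_scale ν hE hζ]
  calc E * ζ ^ thicknessExponent k / (5 * c) * S.traceForm 1 ν 1 1 v v k
      ≤ E * ζ ^ thicknessExponent k / (5 * c) * (c * e ⟨v, hv⟩ ⟨v, hv⟩) :=
        mul_le_mul_of_nonneg_left (hbound ⟨v, hv⟩) (by positivity)
    _ = 1 / 5 * (E * ζ ^ thicknessExponent k * e ⟨v, hv⟩ ⟨v, hv⟩) := by field_simp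
    _ ≤ 1 / 5 * S.energy E ν ζ v v :=
        mul_le_mul_of_nonneg_left (hle E ζ hE hζ ⟨v, hv⟩) (by norm_num)

lemma IsSplineSpace.exists_trace_inequality {V : Submodule ℝ (Plane → Space)}
    (hV : S.IsSplineSpace V) (hS : S.IsAdmissible) {ν : ℝ} (hν₀ : 0 ≤ ν) (hν₁ : ν ≤ 1 / 2)
    (k : Fin 5) : ∃ C, 0 < C ∧ ∀ E ζ : ℝ, 0 < E → 0 < ζ → ∀ v ∈ V,
      S.traceForm E ν ζ C v v k ≤ 1 / 5 * S.energy E ν ζ v v := by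
  have hV' : ∀ w ∈ V, ∀ i, ContDiffOn ℝ 3 w (S.cell i) := fun w hw => hV.contDiffOn_cell hS hw
  by_cases hk : k = 4
  · subst hk
    refine hV.exists_trace_constant hS (hS.memEnergy_isPosForm hV' one_pos hν₀ hν₁ one_pos)
      (fun v hv => hS.traceForm_eq_zero_of_memStrain
        ((hS.memEnergy_eq_zero_iff hV' one_pos hν₀ hν₁ one_pos v).1 hv))
      fun E ζ hE hζ v => ?_
    rw [show ζ ^ thicknessExponent 4 = ζ from pow_one ζ, ← memEnergy_scale]
    exact le_add_of_nonneg_right ((hS.bendEnergy_isPosForm hV' hE hν₀ hν₁ hζ).nonneg v)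
  · refine hV.exists_trace_constant hS (hS.bendEnergy_isPosForm hV' one_pos hν₀ hν₁ one_pos)
      (fun v hv => hS.traceForm_eq_zero_of_bendStrain
        ((hS.bendEnergy_eq_zero_iff hV' one_pos hν₀ hν₁ one_pos v).1 hv) hk)
      fun E ζ hE hζ v => ?_
    have h3 : thicknessExponent k = 3 := by
      fin_cases k <;> first | rfl | exact absurd rfl hk
    rw [h3, ← bendEnergy_scale]
    exact le_add_of_nonneg_left ((hS.memEnergy_isPosForm hV' hE hν₀ hν₁ hζ).nonneg v)

lemma IsSplineSpace.exists_greatest_traceEigenvalue {V : Submodule ℝ (Plane → Space)}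
    (hV : S.IsSplineSpace V) (hS : S.IsAdmissible) {ν : ℝ} (hν₀ : 0 ≤ ν) (hν₁ : ν ≤ 1 / 2)
    {E ζ : ℝ} (hE : 0 < E) (hζ : 0 < ζ) (k : Fin 5) (hne : ∃ v ∈ S.rigidCompl V, v ≠ 0) :
    ∃ μ : ℝ, IsGreatest (S.traceEigenvalues E ν ζ V k) μ ∧ 0 ≤ μ ∧ ∀ c : ℝ, 0 < c →
      ((∀ v ∈ V, S.traceForm E ν ζ c v v k ≤ 1 / 5 * S.energy E ν ζ v v) ↔ 5 * μ ≤ c) := by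
  have hfin := hV.finiteDimensional
  have hV' : ∀ w ∈ V, ∀ i, ContDiffOn ℝ 3 w (S.cell i) := fun w hw => hV.contDiffOn_cell hS hw
  have hrig := hS.energy_eq_zero_iff hV' hE hν₀ hν₁ hζ
  have hcompl : ∀ v : V, (v : Plane → Space) ∈ S.rigidCompl V ↔
      ∀ r : V, S.energy E ν ζ r r = 0 → S.innerL2 v r = 0 := fun v =>
    ⟨fun h r hr => h.2 r ((hrig r).1 hr),
      fun h => ⟨v.2, fun r hr => h ⟨r, hr.1⟩ ((hrig ⟨r, hr.1⟩).2 hr)⟩⟩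
  have hker : ∀ v : V, S.energy E ν ζ v v = 0 → S.traceForm E ν ζ 1 v v k = 0 := fun v hv => by
    have h := ((hrig v).1 hv).2
    by_cases hk : k = 4
    · rw [hk]
      exact hS.traceForm_eq_zero_of_memStrain fun i p hp => (h i p hp).1
    · exact hS.traceForm_eq_zero_of_bendStrain (fun i p hp => (h i p hp).2) hk
  obtain ⟨v₀, hv₀, h₀⟩ := hne
  obtain ⟨μ, hgreat, hμ, hiff⟩ := (hS.innerL2_isPosForm hV').exists_greatest_eigenvalue
    (hV.eq_zero_of_innerL2 hS) (hS.energy_isPosForm hV' hE hν₀ hν₁ hζ)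
    (hS.traceForm_isPosForm hV' (E := E) (ν := ν) hζ one_pos k) hker
    ⟨⟨v₀, hv₀.1⟩, (hcompl ⟨v₀, hv₀.1⟩).1 hv₀, fun h => h₀ (congrArg Subtype.val h)⟩
  refine ⟨μ, ?_, hμ, fun c hc => ?_⟩
  · convert hgreat using 1
    ext l
    constructor
    · rintro ⟨u, hu, hu0, h⟩
      exact ⟨⟨u, hu.1⟩, (hcompl ⟨u, hu.1⟩).1 hu, fun h' => hu0 (congrArg Subtype.val h'),
        fun w hw => h w ((hcompl w).2 hw)⟩
    · rintro ⟨u, hu, hu0, h⟩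
      exact ⟨u, (hcompl u).2 hu, fun h' => hu0 (Subtype.ext h'),
        fun w hw => h ⟨w, hw.1⟩ ((hcompl ⟨w, hw.1⟩).1 hw)⟩
  · have hdiv : ∀ v : V, S.traceForm E ν ζ c v v k = S.traceForm E ν ζ 1 v v k / c := fun v => by
      rw [hS.traceForm_scale ν hE hζ, hS.traceForm_scale ν hE hζ 1]
      ring
    rw [← le_div_iff₀' (by norm_num : (0 : ℝ) < 5), ← hiff]
    have hstep : ∀ v : V, S.traceForm E ν ζ c v v k ≤ 1 / 5 * S.energy E ν ζ v v ↔
        S.traceForm E ν ζ 1 v v k ≤ c / 5 * S.energy E ν ζ v v := fun v => by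
      rw [hdiv, div_le_iff₀ hc]
      constructor <;> intro h <;> linarith
    exact ⟨fun h v => (hstep v).1 (h v v.2), fun h v hv => (hstep ⟨v, hv⟩).2 (h ⟨v, hv⟩)⟩

end ShellData

theorem mainTheorem6 (S : ShellData) (hS : S.IsAdmissible)
    (V : Submodule ℝ (Plane → Space)) (hV : S.IsSplineSpace V)
    (ν : ℝ) (hν₀ : 0 ≤ ν) (hν₁ : ν ≤ 1 / 2) :
    (∃ C : Fin 5 → ℝ, (∀ k, 0 < C k) ∧
      ∀ E ζ : ℝ, 0 < E → 0 < ζ → ∀ v ∈ V, ∀ k,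
        S.traceForm E ν ζ (C k) v v k ≤ 1 / 5 * S.energy E ν ζ v v) ∧
    (∀ E ζ : ℝ, 0 < E → 0 < ζ → ∀ k, (∃ v ∈ S.rigidCompl V, v ≠ 0) →
      ∃ μ : ℝ, IsGreatest (S.traceEigenvalues E ν ζ V k) μ ∧ 0 ≤ μ ∧
        ∀ c : ℝ, 0 < c →
          ((∀ v ∈ V, S.traceForm E ν ζ c v v k ≤ 1 / 5 * S.energy E ν ζ v v) ↔ 5 * μ ≤ c)) := by
  constructor
  · choose C hC h using hV.exists_trace_inequality hS hν₀ hν₁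
    exact ⟨C, hC, fun E ζ hE hζ v hv k => h k E ζ hE hζ v hv⟩
  · intro E ζ hE hζ k hne
    exact hV.exists_greatest_traceEigenvalue hS hν₀ hν₁ hE hζ k hne
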